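/- Let $q=[A,B,C]=Ax^2+Bxy+Cy^2$ denote an integral binary quadratic form, $D=B^2-4AC$ its discriminant. A primitive indefinite binary quadratic form (PIBQF) is one with $\gcd(A,B,C)=1$ and $D>0$ not a perfect square. Its first and second roots are $q_f=\frac{-B+\sqrt D}{2A}$ and $q_s=\frac{-B-\sqrt D}{2A}$, and its root geodesic $\ell_q$ is the hyperbolic geodesic of the upper half plane $\mathbb H$ running from $q_s$ to $q_f$. Let $\Gamma=\mathrm{PSL}(2,\mathbb Z)$ act on forms by $\left(\begin{smallmatrix}a&b\\c&d\end{smallmatrix}\right)\circ q(x,y)=q(ax+by,cx+dy)$, and let $\Gamma_q$ be the stabilizer of $q$. The image of $\ell_q$ in $\Gamma\backslash\mathbb H$ is a closed curve $\tilde\ell_q=\ell_q/\Gamma_q$. *Intersection numbers.* A transverse intersection of $\tilde\ell_{q_1}$ and $\tilde\ell_{q_2}$ is a triple $(z_1,\sigma,z_2)$ with $z_i\in\ell_{q_i}$, $\sigma\in\Gamma$, $\sigma z_1=z_2$ and $\sigma\ell_{q_1}\ne\ell_{q_2}$, modulo $(z_1,\sigma,z_2)\sim(g_1z_1,\,g_2\sigma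 g_1^{-1},\,g_2z_2)$ for $g_i\in\Gamma_{q_i}$. (So intersections are counted with multiplicity, once for every pair of branches that meet.) If the oriented geodesics $\ell_1,\ell_2$ meet in a unique point, the sign $\mathrm{sg}(\ell_1,\ell_2)$ is $+1$ if the starting point of $\ell_2$ lies on the right hand side of $\ell_1$, and $-1$ otherwise. The unweighted intersection number $\mathrm{Int}(q_1,q_2)$ is the number of transverse intersections, and the signed intersection number $\mathrm{Int}^{\pm}(q_1,q_2)$ is the sum over them of $\mathrm{sg}(\sigma\ell_{q_1},\ell_{q_2})$. *Topographs and rivers.* Let $G$ be the infinite 3-regular tree drawn in the plane. The topograph $T$ of $q$ assigns a form to every oriented edge of $G$: $q$ to a fixed base edge, and, if $q'$ is assigned to $e$, then $[C',-B',A']$ to the reversed edge, $[A',B'+2A',A'+B'+C']$ to the edge following $e$ on the left, and $[A'+B'+C',B'+2C',C']$ to the edge following $e$ on the right, where $q'=[A',B',C']$. Here $A'$ and $C'$ are the numbers written in the regions to the left and to the right of $e$. The river $R$ of $q$ is the path of the edges that separate positive from negative regions, flowing in the direction that has the positive regions on its left. Its periods are the orientation-preserving automorphisms of the plane tree $G$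 that carry $R$ to itself together with its flow. A superposition of the topographs $T_1,T_2$ of $q_1,q_2$ is an orientation-preserving identification of their underlying plane trees. It is determined by identifying an oriented edge of $T_1$ with an oriented edge of $T_2$. The superimposed rivers $R_1,R_2$ *meet and cross* if $R_2$ joins $R_1$ from one side and leaves it to the other side, where sides are taken with respect to the flow of $R_1$. Superpositions are counted modulo the periods of the two rivers, i.e. $\varphi\sim\tau_2\varphi\tau_1$ for periods $\tau_i$ of $R_i$. **Theorem.** Let $q_1,q_2$ be PIBQFs. 1. Superimpose $T_1$ and $T_2$, and let $f_1,f_2$ be the forms that $T_1,T_2$ assign to any two oriented edges which are identified. Then $\ell_{f_1},\ell_{f_2}$ intersect in a unique point of $\mathbb H$ if and only if the superimposed rivers $R_1,R_2$ meet and cross, and $\ell_{f_1},\ell_{f_2}$ completely overlap if and only if $R_1,R_2$ completely overlap. If $\ell_{f_1},\ell_{f_2}$ intersect in a unique point, then $\mathrm{sg}(\ell_{f_1},\ell_{f_2})=1$ if and only if $R_2$ joins $R_1$ from the right, and $\mathrm{sg}(\ell_{f_1},\ell_{f_2})=-1$ if and only if $R_2$ joins $R_1$ from the left. 2. The set of transverse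 intersections, and the set of superpositions for which $R_1,R_2$ meet and cross modulo the periods of the rivers, are finite, and $\mathrm{Int}(q_1,q_2)$ is equal to the number of elements of the latter. 3. $\mathrm{Int}^{\pm}(q_1,q_2)$ is the same count of superpositions modulo periods, except that $1$ is added when $R_2$ joins $R_1$ from the right and $-1$ when $R_2$ joins $R_1$ from the left. -/

import Mathlib

open scoped UpperHalfPlane MatrixGroups

namespace ModularTopograph

/-! ### Binary quadratic forms -/

/-- The binary quadratic form `[A, B, C] = A x² + B x y + C y²` with integer coefficients. -/
@[ext]
structure BQF where
  A : ℤ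
  B : ℤ
  C : ℤ

/-- The discriminant `B² - 4AC`. -/
def BQF.disc (q : BQF) : ℤ := q.B ^ 2 - 4 * q.A * q.C

/-- Primitive indefinite binary quadratic forms: the coefficients have no common factor and the
discriminant is positive and not a perfect square. -/
structure BQF.IsPIBQF (q : BQF) : Prop where
  primitive : ∀ n : ℤ, n ∣ q.A → n ∣ q.B → n ∣ q.C → IsUnit n
  disc_pos : 0 < q.disc
  disc_not_square : ¬ IsSquare q.disc

/-- The right action of the modular group on forms:
`(g ∘ q)(x, y) = q (a x + b y, c x + d y)` for `g = (a, b; c, d)`. -/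
def BQF.act (g : SL(2, ℤ)) (q : BQF) : BQF where
  A := q.A * g 0 0 ^ 2 + q.B * g 0 0 * g 1 0 + q.C * g 1 0 ^ 2
  B := 2 * q.A * g 0 0 * g 0 1 + q.B * (g 0 0 * g 1 1 + g 0 1 * g 1 0)
    + 2 * q.C * g 1 0 * g 1 1
  C := q.A * g 0 1 ^ 2 + q.B * g 0 1 * g 1 1 + q.C * g 1 1 ^ 2

theorem BQF.act_one (q : BQF) : BQF.act 1 q = q := by
  ext <;> simp [BQF.act]

theorem BQF.act_mul (g h : SL(2, ℤ)) (q : BQF) :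
    BQF.act (g * h) q = BQF.act h (BQF.act g q) := by
  ext <;> simp [BQF.act, Matrix.mul_apply, Fin.sum_univ_two] <;> ring

/-- The automorphs of `q`: its stabilizer in `SL(2, ℤ)`. For a PIBQF it is `± γ_q ^ ℤ`, where
`γ_q` is the invariant automorph. -/
def BQF.automorphs (q : BQF) : Subgroup SL(2, ℤ) where
  carrier := {g | BQF.act g q = q}
  one_mem' := BQF.act_one q
  mul_mem' := by
    intro g h hg hh
    simp only [Set.mem_ofPred_eq] at hg hh ⊢
    rw [BQF.act_mul, hg, hh]
  inv_mem' := by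
    intro g hg
    simp only [Set.mem_ofPred_eq] at hg ⊢
    have h := BQF.act_mul g g⁻¹ q
    rw [mul_inv_cancel, BQF.act_one, hg] at h
    exact h.symm

/-! ### Root geodesics and their intersections on the modular curve -/

/-- The first root `(-B + √D) / (2A)`. -/
noncomputable def BQF.firstRoot (q : BQF) : ℝ :=
  (-(q.B : ℝ) + Real.sqrt (q.disc : ℝ)) / (2 * (q.A : ℝ))

/-- The second root `(-B - √D) / (2A)`. -/
noncomputable def BQF.secondRoot (q : BQF) : ℝ :=
  (-(q.B : ℝ) - Real.sqrt (q.disc : ℝ)) / (2 * (q.A : ℝ))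

/-- The hyperbolic geodesic of the upper half plane with distinct real end points `x`, `y`: the
semicircle centred on the real line. -/
def geodesic (x y : ℝ) : Set ℍ :=
  {z | dist (z : ℂ) (((x + y) / 2 : ℝ) : ℂ) = |x - y| / 2}

/-- The root geodesic `ℓ_q`, running from the second root to the first root. (A PIBQF has
`A ≠ 0`, so that its roots are two distinct real numbers.) -/
noncomputable def BQF.rootGeodesic (q : BQF) : Set ℍ := geodesic q.secondRoot q.firstRoot

/-- The real number `x` lies on the right hand side of the geodesic travelled from `y₁` to `y₂`:
inside the semicircle if it is travelled from left to right, outside otherwise. -/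
def RightOf (y₁ y₂ x : ℝ) : Prop :=
  (y₁ < y₂ ∧ y₁ < x ∧ x < y₂) ∨ (y₂ < y₁ ∧ (x < y₂ ∨ y₁ < x))

open Classical in
/-- The sign of the intersection of a geodesic running from `y₁` to `y₂` with a geodesic that
starts at `z₁`: it is `+1` if `z₁` is on the right of the former, and `-1` otherwise. -/
noncomputable def geodesicSign (y₁ y₂ z₁ : ℝ) : ℤ := if RightOf y₁ y₂ z₁ then 1 else -1

/-- The sign of the intersection of the root geodesics of `q₁`, `q₂` (in this order). -/
noncomputable def BQF.sg (q₁ q₂ : BQF) : ℤ :=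
  geodesicSign q₁.secondRoot q₁.firstRoot q₂.secondRoot

/-- The Möbius action on a real number. It is only used at irrational numbers, where the
denominator does not vanish. -/
noncomputable def moebius (g : SL(2, ℤ)) (x : ℝ) : ℝ :=
  ((g 0 0 : ℝ) * x + (g 0 1 : ℝ)) / ((g 1 0 : ℝ) * x + (g 1 1 : ℝ))

/-- A transverse intersection of the closed modular geodesics of `q₁` and `q₂`, before passing to
the closed curves: points `z₁`, `z₂` on the two root geodesics which agree on the modular curve,
namely `σ z₁ = z₂` with `σ` in the modular group, such that the geodesics `σ ℓ_{q₁}` and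
`ℓ_{q₂}`, which both pass through `z₂`, do not overlap. Away from the elliptic points `σ` is
determined up to sign by `z₁` and `z₂`; at an elliptic point, `σ` records which branches of the
lifted curves meet. -/
structure LiftedIntersection (q₁ q₂ : BQF) where
  z₁ : ℍ
  z₂ : ℍ
  σ : SL(2, ℤ)
  mem₁ : z₁ ∈ q₁.rootGeodesic
  mem₂ : z₂ ∈ q₂.rootGeodesic
  smul_eq : σ • z₁ = z₂
  transverse : (fun z : ℍ => σ • z) '' q₁.rootGeodesic ≠ q₂.rootGeodesic

/-- The closed geodesic of `q` is `ℓ_q` modulo the automorphs of `q`, so two lifts are the same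
intersection if they differ by automorphs of `q₁` and `q₂`. -/
def liftSetoid (q₁ q₂ : BQF) : Setoid (LiftedIntersection q₁ q₂) where
  r x y := ∃ g₁ ∈ q₁.automorphs, ∃ g₂ ∈ q₂.automorphs,
    y.z₁ = g₁ • x.z₁ ∧ y.z₂ = g₂ • x.z₂ ∧ y.σ = g₂ * x.σ * g₁⁻¹
  iseqv :=
    { refl := fun x => ⟨1, one_mem _, 1, one_mem _, by simp, by simp, by simp⟩
      symm := by
        rintro x y ⟨g₁, h₁, g₂, h₂, e₁, e₂, e₃⟩
        refine ⟨g₁⁻¹, inv_mem h₁, g₂⁻¹, inv_mem h₂, by simp [e₁], by simp [e₂], ?_⟩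
        rw [e₃]; group
      trans := by
        rintro x y w ⟨g₁, h₁, g₂, h₂, e₁, e₂, e₃⟩ ⟨k₁, l₁, k₂, l₂, f₁, f₂, f₃⟩
        refine ⟨k₁ * g₁, mul_mem l₁ h₁, k₂ * g₂, mul_mem l₂ h₂, ?_, ?_, ?_⟩
        · rw [f₁, e₁, mul_smul]
        · rw [f₂, e₂, mul_smul]
        · rw [f₃, e₃]; group }

/-- The transverse intersections of the closed modular geodesics of `q₁` and `q₂`. -/
def Intersections (q₁ q₂ : BQF) : Type := Quotient (liftSetoid q₁ q₂)

/-- The unweighted intersection number. -/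
noncomputable def intNumber (q₁ q₂ : BQF) : ℕ := Nat.card (Intersections q₁ q₂)

/-- The sign of the intersection of `σ ℓ_{q₁}` (running from `σ` of the second root to `σ` of the
first root) with `ℓ_{q₂}`. -/
noncomputable def LiftedIntersection.sign {q₁ q₂ : BQF} (x : LiftedIntersection q₁ q₂) : ℤ :=
  geodesicSign (moebius x.σ q₁.secondRoot) (moebius x.σ q₁.firstRoot) q₂.secondRoot

/-- The signed intersection number: the sum of the signs of the intersections. (The sign does not
depend on the lift.) -/
noncomputable def signedIntNumber (q₁ q₂ : BQF) : ℤ :=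
  ∑ᶠ p : Intersections q₁ q₂, (Quotient.out p : LiftedIntersection q₁ q₂).sign

/-! ### The infinite 3-regular tree in the plane -/

/-- A left or a right turn. -/
inductive Turn where
  | L
  | R

/-- The vertices of the infinite 3-regular tree drawn in the plane. One edge is chosen as root;
`side` tells towards which of its two ends it is left, and `path` lists the turns that are taken
after that, the last one first. -/
structure Vertex where
  side : Bool
  path : List Turn

/-- The three edges at a vertex: the one pointing back to the root edge, and, when the vertex is
entered along that edge, the left and the right branch. For the vertices of the root edge, `back`
is the root edge. -/
inductive Slot where
  | back
  | left
  | right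

/-- The next edge at a vertex in clockwise order. -/
def Slot.clockwise : Slot → Slot
  | .back => .left
  | .left => .right
  | .right => .back

/-- The branch which is taken by a turn. -/
def Turn.slot : Turn → Slot
  | .L => .left
  | .R => .right

/-- Oriented edges, i.e. pairs `(E, V)` of an edge `E` and an end `V` of `E`; the edge is recorded
by its slot at `V`. The orientation is towards `V`. -/
structure Dart where
  vertex : Vertex
  slot : Slot

/-- The opposite orientation of the same edge. -/
def Dart.rev : Dart → Dart
  | ⟨⟨b, []⟩, .back⟩ => ⟨⟨!b, []⟩, .back⟩
  | ⟨⟨b, t :: w⟩, .back⟩ => ⟨⟨b, w⟩, t.slot⟩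
  | ⟨⟨b, w⟩, .left⟩ => ⟨⟨b, .L :: w⟩, .back⟩
  | ⟨⟨b, w⟩, .right⟩ => ⟨⟨b, .R :: w⟩, .back⟩

/-- Move along the oriented edge to its end, and take the left branch. -/
def Dart.leftTurn (d : Dart) : Dart := Dart.rev ⟨d.vertex, d.slot.clockwise⟩

/-- Move along the oriented edge to its end, and take the right branch. -/
def Dart.rightTurn (d : Dart) : Dart := Dart.rev ⟨d.vertex, d.slot.clockwise.clockwise⟩

/-- The orientation preserving automorphisms of the plane tree, as permutations of the oriented
edges: they respect the reversal of edges and left branches (hence the vertices and the cyclic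
order of the three edges at each vertex). -/
def planeAut : Subgroup (Equiv.Perm Dart) where
  carrier := {f | (∀ d, f d.rev = (f d).rev) ∧ ∀ d, f d.leftTurn = (f d).leftTurn}
  one_mem' := by simp
  mul_mem' := by
    rintro f g ⟨hf, hf₂⟩ ⟨hg, hg₂⟩
    exact ⟨fun d => by simp [hg, hf], fun d => by simp [hg₂, hf₂]⟩
  inv_mem' := by
    rintro f ⟨hf, hf₂⟩
    refine ⟨fun d => ?_, fun d => ?_⟩
    · rw [Equiv.Perm.inv_eq_iff_eq, hf]; simp
    · rw [Equiv.Perm.inv_eq_iff_eq, hf₂]; simp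

/-! ### Topographs and rivers -/

/-- The matrix `S`, which reverses an oriented edge. -/
def matS : SL(2, ℤ) := ⟨!![0, 1; -1, 0], by simp [Matrix.det_fin_two]⟩

/-- The matrices of the two turns: `L = T = (1, 1; 0, 1)` and `R = (1, 0; 1, 1)`. -/
def Turn.mat : Turn → SL(2, ℤ)
  | .L => ⟨!![1, 1; 0, 1], by simp [Matrix.det_fin_two]⟩
  | .R => ⟨!![1, 0; 1, 1], by simp [Matrix.det_fin_two]⟩

/-- The matrix of the route that starts at the root edge, oriented towards its end `true`, and
ends at the edge `back` of the given vertex, oriented towards that vertex: every turn, and the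
reversal of the orientation, multiplies by the corresponding matrix on the right. -/
def routeMat : Bool → List Turn → SL(2, ℤ)
  | true, [] => 1
  | false, [] => matS
  | b, t :: w => routeMat b w * t.mat

/-- The matrix `M` for which the oriented edge is `M ∘ (E, V)`, where `(E, V)` is the root edge
oriented towards its end `true`. -/
def Dart.mat : Dart → SL(2, ℤ)
  | ⟨⟨b, w⟩, .back⟩ => routeMat b w
  | ⟨⟨b, w⟩, .left⟩ => routeMat b (.L :: w) * matS
  | ⟨⟨b, w⟩, .right⟩ => routeMat b (.R :: w) * matS

/-- The topograph of `q`, given by the form that is read off at each oriented edge, with `q` itself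
at the root edge. If `[A, B, C]` is read off at an oriented edge, then `A` is the number in the
region on its left, `C` the number in the region on its right, `|B|` the number on the edge, and
the arrow on the edge has the given orientation if `B > 0` and the opposite one if `B < 0`. -/
def topograph (q : BQF) (d : Dart) : BQF := BQF.act d.mat q

/-- The river with its flow: the edges that separate a positive from a negative region, oriented
such that the positive region is on the left. -/
def river (q : BQF) : Set Dart := {d | 0 < (topograph q d).A ∧ (topograph q d).C < 0}

/-- A path `Y` comes from the right of `X` when it reaches `X`: at some vertex, `X` takes the left
branch while `Y` arrives along the right branch. -/
def JoinsFromRight (X Y : Set Dart) : Prop :=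
  ∃ d ∈ X, d.leftTurn ∈ X ∧ d.rightTurn.rev ∈ Y

/-- A path `Y` comes from the left of `X` when it reaches `X`. -/
def JoinsFromLeft (X Y : Set Dart) : Prop :=
  ∃ d ∈ X, d.rightTurn ∈ X ∧ d.leftTurn.rev ∈ Y

/-- A path `Y` leaves `X` to the right: at some vertex, `X` takes the left branch and `Y` departs
along the right branch. -/
def LeavesToRight (X Y : Set Dart) : Prop :=
  ∃ d ∈ X, d.leftTurn ∈ X ∧ d.rightTurn ∈ Y

/-- A path `Y` leaves `X` to the left. -/
def LeavesToLeft (X Y : Set Dart) : Prop :=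
  ∃ d ∈ X, d.rightTurn ∈ X ∧ d.leftTurn ∈ Y

/-- The paths `X`, `Y` meet and cross: `Y` joins `X` from one side and leaves it to the other. -/
def MeetAndCross (X Y : Set Dart) : Prop :=
  (JoinsFromRight X Y ∧ LeavesToLeft X Y) ∨ (JoinsFromLeft X Y ∧ LeavesToRight X Y)

/-- The paths `X`, `Y` run through the same edges, not necessarily in the same direction. -/
def CompletelyOverlap (X Y : Set Dart) : Prop :=
  ∀ d : Dart, (d ∈ X ∨ d.rev ∈ X) ↔ (d ∈ Y ∨ d.rev ∈ Y)

/-- The periods of the river of `q`: the automorphisms of the plane tree that shift the river along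
itself, i.e. carry it to itself together with its flow. -/
def riverPeriods (q : BQF) : Subgroup planeAut where
  carrier := {τ | ∀ d, τ.1 d ∈ river q ↔ d ∈ river q}
  one_mem' := by simp
  mul_mem' := by
    intro f g hf hg d
    have h₁ := hf (g.1 d)
    have h₂ := hg d
    simpa using h₁.trans h₂
  inv_mem' := by
    intro f hf d
    have h := hf (f.1⁻¹ d)
    simpa using h.symm

/-- The river of `q₁`, drawn in the plane of the second topograph after superimposing the first
topograph on it by means of `φ`. -/
def superimposedRiver (q₁ : BQF) (φ : planeAut) : Set Dart := φ.1 '' river q₁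

/-- The ways to superimpose the topographs of `q₁` and `q₂` (identifications `φ` of the plane tree
of the first with the plane tree of the second) such that the rivers meet and cross. -/
def CrossingSuperposition (q₁ q₂ : BQF) : Type :=
  {φ : planeAut // MeetAndCross (superimposedRiver q₁ φ) (river q₂)}

/-- Equality of superpositions modulo the periods of the two rivers. -/
def periodSetoid (q₁ q₂ : BQF) : Setoid (CrossingSuperposition q₁ q₂) where
  r φ ψ := ∃ τ₁ ∈ riverPeriods q₁, ∃ τ₂ ∈ riverPeriods q₂, ψ.1 = τ₂ * φ.1 * τ₁
  iseqv :=
    { refl := fun x => ⟨1, one_mem _, 1, one_mem _, by simp⟩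
      symm := by
        rintro x y ⟨g₁, h₁, g₂, h₂, e⟩
        refine ⟨g₁⁻¹, inv_mem h₁, g₂⁻¹, inv_mem h₂, ?_⟩
        rw [e]; group
      trans := by
        rintro x y w ⟨g₁, h₁, g₂, h₂, e⟩ ⟨k₁, l₁, k₂, l₂, f⟩
        refine ⟨g₁ * k₁, mul_mem h₁ l₁, k₂ * g₂, mul_mem l₂ h₂, ?_⟩
        rw [f, e]; group }

/-- The ways to superimpose the topographs such that the rivers meet and cross, modulo the periods
of the rivers. -/
def RiverCrossings (q₁ q₂ : BQF) : Type := Quotient (periodSetoid q₁ q₂)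

open Classical in
/-- `+1` if the river of `q₂` joins the river of `q₁` from the right, and `-1` otherwise, that is,
if it joins from the left. -/
noncomputable def CrossingSuperposition.sign {q₁ q₂ : BQF} (φ : CrossingSuperposition q₁ q₂) : ℤ :=
  if JoinsFromRight (superimposedRiver q₁ φ.1) (river q₂) then 1 else -1

/-- The signed number of river crossings. (The sign does not depend on the representative.) -/
noncomputable def signedRiverCrossings (q₁ q₂ : BQF) : ℤ :=
  ∑ᶠ c : RiverCrossings q₁ q₂, (Quotient.out c : CrossingSuperposition q₁ q₂).sign

end ModularTopograph

open ModularTopograph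

/-!
Oriented edges of the plane tree are the elements of `PSL(2, ℤ)`: an edge corresponds to its matrix,
reversal and the two turns are right multiplications by `S`, `L`, `R` (`Dart.mat_rev`,
`Dart.mat_leftTurn`, `Dart.mat_rightTurn`), every matrix occurs because `S` and `T` generate
(`Dart.exists_mat`), and only once because `L` and `R` generate a free monoid
(`Dart.mat_injective`). Hence the automorphisms of the plane tree are the left multiplications by
elements `σ` of `PSL(2, ℤ)` (`exists_inducedBy`, `exists_planeAut`), and superimposing the topograph
of `q₁` by means of `σ` amounts to replacing `q₁` by `p = σ⁻¹ ∘ q₁`, whose root geodesic is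
`σ ℓ_{q₁}`. All statements thus become statements about two forms `p`, `q` on one tree.

Both sides of the crossing criterion are governed by the signs of `p` at the two roots `x₁`, `x₂`
of `q`. These signs are invariant under simultaneous modular transformations, since `x₁` and `x₂`
transform by Möbius maps. On the geometric side, `p(x₁) p(x₂)` is the resultant of `p` and `q` up to
a positive factor, and it is negative if and only if the linear equations for a common point of the
root geodesics have a solution in the upper half plane (`existsUnique_common_point_iff`); the
second root lies on the right of `ℓ_p` if and only if `p(x₂) < 0` (`rightOf_iff_eval_neg`).
On the combinatorial side, a vertex where the river of `q` joins that of `p` from the right locates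
`x₂`, in the coordinates given by this vertex, in the interval `(0, 1)` where `p` is negative, and
similarly in the three other cases. Conversely, followed forwards the river of `q` converges to
`x₁`: the linear form with root `x₂` grows along it (`exists_river_walk`), whereas the values of
`q` stay bounded, so that the sign of `p` on both banks is finally that of `p(x₁)`. Backwards it
comes from the region where `p` has the sign of `p(x₂)`. If the two signs differ, there is a first edge at
which the river of `q` reaches the river of `p` (`exists_joining_edge`). If `p(x₁) ≠ 0`, the same
convergence shows that the rivers do not overlap; if `p(x₁) = 0`, then `p` and `q` are
proportional, as `x₁` is irrational.

The last fact also identifies the periods of a river with the automorphs of the form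
(`mem_riverPeriods_iff`), so that transverse intersections and crossing superpositions are given by
the same `σ` modulo the same group actions (`intersectionsEquiv`). They are finite in number:
a crossing is determined modulo periods by the two forms at a common edge of the rivers, and the
coefficients of forms on a river are bounded by the discriminant.
-/

namespace ModularTopograph

/-! ### Forms, their values and their roots -/

/-- The discriminant is positive and not a square, i.e. the form has two distinct real roots, which
are irrational. -/
structure BQF.IsAnisotropic (q : BQF) : Prop where
  disc_pos : 0 < q.disc
  disc_not_square : ¬ IsSquare q.disc

theorem BQF.IsPIBQF.isAnisotropic {q : BQF} (h : q.IsPIBQF) : q.IsAnisotropic :=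
  ⟨h.disc_pos, h.disc_not_square⟩

/-- The value `q(x, 1)` at a real number. -/
def BQF.eval (q : BQF) (x : ℝ) : ℝ := q.A * x ^ 2 + q.B * x + q.C

/-- The form `-q`. It has the same root geodesic and the same river as `q`, with the opposite
orientations. -/
def BQF.neg (q : BQF) : BQF := ⟨-q.A, -q.B, -q.C⟩

theorem det_eq_one (g : SL(2, ℤ)) : g 0 0 * g 1 1 - g 0 1 * g 1 0 = 1 := by
  have h := g.det_coe
  rwa [Matrix.det_fin_two] at h

theorem inv_entries (g : SL(2, ℤ)) :
    g⁻¹ 0 0 = g 1 1 ∧ g⁻¹ 0 1 = -g 0 1 ∧ g⁻¹ 1 0 = -g 1 0 ∧ g⁻¹ 1 1 = g 0 0 := by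
  simp [Matrix.SpecialLinearGroup.coe_inv, Matrix.adjugate_fin_two]

namespace BQF

@[simp] theorem neg_A (q : BQF) : q.neg.A = -q.A := rfl
@[simp] theorem neg_B (q : BQF) : q.neg.B = -q.B := rfl
@[simp] theorem neg_C (q : BQF) : q.neg.C = -q.C := rfl

theorem disc_neg (q : BQF) : q.neg.disc = q.disc := by simp [disc, neg]

theorem act_neg_form (g : SL(2, ℤ)) (q : BQF) : act g q.neg = (act g q).neg := by
  ext <;> simp [act, neg] <;> ring

theorem act_neg_mat (g : SL(2, ℤ)) (q : BQF) : act (-g) q = act g q := by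
  ext <;> simp [act]

theorem act_inv_act (g : SL(2, ℤ)) (q : BQF) : act g (act g⁻¹ q) = q := by
  rw [← act_mul, inv_mul_cancel, act_one]

theorem disc_act (g : SL(2, ℤ)) (q : BQF) : (act g q).disc = q.disc := by
  have h : (act g q).disc = (g 0 0 * g 1 1 - g 0 1 * g 1 0) ^ 2 * q.disc := by
    simp only [disc, act]; ring
  rw [h, det_eq_one]; ring

theorem eval_neg (q : BQF) (x : ℝ) : q.neg.eval x = -q.eval x := by
  simp [eval, neg]; ring

namespace IsAnisotropic

theorem act {q : BQF} (h : q.IsAnisotropic) (g : SL(2, ℤ)) : (BQF.act g q).IsAnisotropic :=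
  ⟨by rw [disc_act]; exact h.1, by rw [disc_act]; exact h.2⟩

theorem neg {q : BQF} (h : q.IsAnisotropic) : q.neg.IsAnisotropic :=
  ⟨by rw [disc_neg]; exact h.1, by rw [disc_neg]; exact h.2⟩

theorem A_ne_zero {q : BQF} (h : q.IsAnisotropic) : q.A ≠ 0 := fun h0 =>
  h.2 ⟨q.B, by simp only [disc, h0]; ring⟩

theorem C_ne_zero {q : BQF} (h : q.IsAnisotropic) : q.C ≠ 0 := fun h0 =>
  h.2 ⟨q.B, by simp only [disc, h0]; ring⟩

theorem sum_ne_zero {q : BQF} (h : q.IsAnisotropic) : q.A + q.B + q.C ≠ 0 := fun h0 =>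
  h.2 ⟨q.A - q.C, by
    have hB : q.B = -q.A - q.C := by linarith
    simp only [disc, hB]; ring⟩

theorem sqrt_disc_pos {q : BQF} (h : q.IsAnisotropic) : 0 < Real.sqrt (q.disc : ℝ) :=
  Real.sqrt_pos.2 (by exact_mod_cast h.1)

theorem sq_sqrt_disc {q : BQF} (h : q.IsAnisotropic) :
    Real.sqrt (q.disc : ℝ) ^ 2 = (q.B : ℝ) ^ 2 - 4 * q.A * q.C := by
  rw [Real.sq_sqrt (by exact_mod_cast h.1.le)]
  simp [disc]

theorem irrational_sqrt_disc {q : BQF} (h : q.IsAnisotropic) :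
    Irrational (Real.sqrt (q.disc : ℝ)) :=
  (irrational_sqrt_intCast_iff_of_nonneg h.1.le).2 h.2

theorem A_cast_ne_zero {q : BQF} (h : q.IsAnisotropic) : (q.A : ℝ) ≠ 0 := by
  exact_mod_cast h.A_ne_zero

theorem firstRoot_spec {q : BQF} (h : q.IsAnisotropic) :
    2 * (q.A : ℝ) * q.firstRoot + q.B = Real.sqrt (q.disc : ℝ) := by
  have := h.A_cast_ne_zero
  simp only [firstRoot]; field_simp; ring

theorem secondRoot_spec {q : BQF} (h : q.IsAnisotropic) :
    2 * (q.A : ℝ) * q.secondRoot + q.B = -Real.sqrt (q.disc : ℝ) := by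
  have := h.A_cast_ne_zero
  simp only [secondRoot]; field_simp; ring

theorem eq_firstRoot {q : BQF} (h : q.IsAnisotropic) {x : ℝ}
    (hx : 2 * (q.A : ℝ) * x + q.B = Real.sqrt (q.disc : ℝ)) : x = q.firstRoot := by
  have h1 := h.firstRoot_spec
  have : (2 * (q.A : ℝ)) * x = 2 * q.A * q.firstRoot := by linarith
  exact mul_left_cancel₀ (mul_ne_zero two_ne_zero h.A_cast_ne_zero) this

theorem eq_secondRoot {q : BQF} (h : q.IsAnisotropic) {x : ℝ}
    (hx : 2 * (q.A : ℝ) * x + q.B = -Real.sqrt (q.disc : ℝ)) : x = q.secondRoot := by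
  have h1 := h.secondRoot_spec
  have : (2 * (q.A : ℝ)) * x = 2 * q.A * q.secondRoot := by linarith
  exact mul_left_cancel₀ (mul_ne_zero two_ne_zero h.A_cast_ne_zero) this

theorem A_mul_roots_sub {q : BQF} (h : q.IsAnisotropic) :
    (q.A : ℝ) * (q.firstRoot - q.secondRoot) = Real.sqrt (q.disc : ℝ) := by
  linarith [h.firstRoot_spec, h.secondRoot_spec]

theorem A_mul_roots_add {q : BQF} (h : q.IsAnisotropic) :
    (q.A : ℝ) * (q.firstRoot + q.secondRoot) = -q.B := by
  linarith [h.firstRoot_spec, h.secondRoot_spec]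

theorem A_mul_roots_mul {q : BQF} (h : q.IsAnisotropic) :
    (q.A : ℝ) * (q.firstRoot * q.secondRoot) = q.C := by
  have h1 := h.A_mul_roots_sub
  have h2 := h.A_mul_roots_add
  have h3 := h.sq_sqrt_disc
  rw [← h1] at h3
  have h4 : (q.B : ℝ) = -(q.A * (q.firstRoot + q.secondRoot)) := by linarith
  rw [h4] at h3
  have h5 : (q.A : ℝ) * (q.A * (q.firstRoot * q.secondRoot)) = q.A * q.C := by linarith
  exact mul_left_cancel₀ h.A_cast_ne_zero h5

theorem eval_eq {q : BQF} (h : q.IsAnisotropic) (x : ℝ) :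
    q.eval x = q.A * (x - q.firstRoot) * (x - q.secondRoot) := by
  have h2 := h.A_mul_roots_add
  have h3 := h.A_mul_roots_mul
  simp only [eval]
  linear_combination x * h2 - h3

theorem eval_firstRoot {q : BQF} (h : q.IsAnisotropic) : q.eval q.firstRoot = 0 := by
  rw [h.eval_eq]; ring

theorem eval_secondRoot {q : BQF} (h : q.IsAnisotropic) : q.eval q.secondRoot = 0 := by
  rw [h.eval_eq]; ring

theorem roots_ne {q : BQF} (h : q.IsAnisotropic) : q.firstRoot ≠ q.secondRoot := fun h0 => by
  have h1 := h.A_mul_roots_sub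
  have h2 := h.sqrt_disc_pos
  rw [h0, sub_self, mul_zero] at h1
  linarith

theorem firstRoot_neg {q : BQF} (h : q.IsAnisotropic) : q.neg.firstRoot = q.secondRoot := by
  refine h.eq_secondRoot ?_
  have := h.neg.firstRoot_spec
  rw [disc_neg] at this
  push_cast [neg_A, neg_B] at this
  linarith

theorem secondRoot_neg {q : BQF} (h : q.IsAnisotropic) : q.neg.secondRoot = q.firstRoot := by
  refine h.eq_firstRoot ?_
  have := h.neg.secondRoot_spec
  rw [disc_neg] at this
  push_cast [neg_A, neg_B] at this
  linarith

theorem irrational_firstRoot {q : BQF} (h : q.IsAnisotropic) : Irrational q.firstRoot := by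
  rintro ⟨r, hr⟩
  refine h.irrational_sqrt_disc ⟨2 * q.A * r + q.B, ?_⟩
  push_cast
  rw [hr, h.firstRoot_spec]

theorem irrational_secondRoot {q : BQF} (h : q.IsAnisotropic) : Irrational q.secondRoot := by
  rw [← h.firstRoot_neg]
  exact h.neg.irrational_firstRoot

end IsAnisotropic
end BQF

theorem eq_zero_of_irrational {x : ℝ} (hx : Irrational x) {m n : ℤ}
    (h : (m : ℝ) * x + n = 0) : m = 0 ∧ n = 0 := by
  have hm : m = 0 := by
    by_contra hm
    have hm' : (m : ℝ) ≠ 0 := by exact_mod_cast hm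
    refine hx ⟨-n / m, ?_⟩
    push_cast
    field_simp
    linarith
  subst hm
  exact ⟨rfl, by simpa using h⟩

theorem denom_ne_zero_of_irrational {x : ℝ} (hx : Irrational x) (g : SL(2, ℤ)) :
    (g 1 0 : ℝ) * x + g 1 1 ≠ 0 := fun h => by
  have h0 := eq_zero_of_irrational hx h
  have h1 := det_eq_one g
  rw [h0.1, h0.2] at h1
  simp at h1

theorem eval_act (g : SL(2, ℤ)) (q : BQF) {x : ℝ} (hx : (g 1 0 : ℝ) * x + g 1 1 ≠ 0) :
    (BQF.act g q).eval x = ((g 1 0 : ℝ) * x + g 1 1) ^ 2 * q.eval (moebius g x) := by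
  simp only [BQF.eval, BQF.act, moebius]
  push_cast
  field_simp
  ring

theorem moebius_inv_mul {x : ℝ} (hx : Irrational x) (g : SL(2, ℤ)) :
    (g 0 0 : ℝ) - g 1 0 * x ≠ 0 ∧
      moebius g⁻¹ x * (g 0 0 - g 1 0 * x) = g 1 1 * x - g 0 1 := by
  have hd := denom_ne_zero_of_irrational hx g⁻¹
  obtain ⟨e1, e2, e3, e4⟩ := inv_entries g
  have e : (g 0 0 : ℝ) - g 1 0 * x = (g⁻¹ 1 0 : ℝ) * x + g⁻¹ 1 1 := by
    rw [e3, e4]; push_cast; ring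
  rw [e]
  refine ⟨hd, ?_⟩
  rw [moebius, div_mul_cancel₀ _ hd, e1, e2]
  push_cast; ring

/-- The derivative of a form at a root does not change under a modular transformation. As it is
`√D` at the first root and `-√D` at the second, this separates the two roots. -/
theorem two_A_moebius_inv (g : SL(2, ℤ)) (q : BQF) {x : ℝ} (hx : Irrational x)
    (h0 : q.eval x = 0) :
    2 * ((BQF.act g q).A : ℝ) * moebius g⁻¹ x + (BQF.act g q).B = 2 * q.A * x + q.B := by
  obtain ⟨hd, hy⟩ := moebius_inv_mul hx g
  have hdet : (g 0 0 : ℝ) * g 1 1 - g 0 1 * g 1 0 = 1 := by exact_mod_cast det_eq_one g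
  refine mul_right_cancel₀ hd ?_
  simp only [BQF.eval] at h0
  simp only [BQF.act]
  push_cast
  linear_combination (2 * (q.A : ℝ) * g 0 0 * x + q.B * g 0 0 + q.B * g 1 0 * x
    + 2 * q.C * g 1 0) * hdet + 2 * (g 1 0 : ℝ) * h0
    + 2 * ((q.A : ℝ) * g 0 0 ^ 2 + q.B * g 0 0 * g 1 0 + q.C * g 1 0 ^ 2) * hy

namespace BQF.IsAnisotropic

theorem firstRoot_act {q : BQF} (h : q.IsAnisotropic) (g : SL(2, ℤ)) :
    (BQF.act g q).firstRoot = moebius g⁻¹ q.firstRoot := by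
  refine ((h.act g).eq_firstRoot ?_).symm
  rw [two_A_moebius_inv g q h.irrational_firstRoot h.eval_firstRoot, h.firstRoot_spec, disc_act]

theorem secondRoot_act {q : BQF} (h : q.IsAnisotropic) (g : SL(2, ℤ)) :
    (BQF.act g q).secondRoot = moebius g⁻¹ q.secondRoot := by
  refine ((h.act g).eq_secondRoot ?_).symm
  rw [two_A_moebius_inv g q h.irrational_secondRoot h.eval_secondRoot, h.secondRoot_spec,
    disc_act]

end BQF.IsAnisotropic

theorem moebius_moebius_inv (g : SL(2, ℤ)) {x : ℝ} (hx : Irrational x)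
    (hd : (g 1 0 : ℝ) * moebius g⁻¹ x + g 1 1 ≠ 0) : moebius g (moebius g⁻¹ x) = x := by
  obtain ⟨hd', hy⟩ := moebius_inv_mul hx g
  rw [moebius, div_eq_iff hd]
  linear_combination hy

theorem eval_act_firstRoot (g : SL(2, ℤ)) (p : BQF) {q : BQF} (h : q.IsAnisotropic) :
    ∃ c : ℝ, 0 < c ∧
      (BQF.act g p).eval (BQF.act g q).firstRoot = c * p.eval q.firstRoot := by
  have hd := denom_ne_zero_of_irrational (h.act g).irrational_firstRoot g
  refine ⟨_, pow_pos (abs_pos.2 hd) 2, ?_⟩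
  rw [eval_act g p hd, sq_abs]
  rw [h.firstRoot_act] at hd ⊢
  rw [moebius_moebius_inv g h.irrational_firstRoot hd]

theorem eval_act_secondRoot (g : SL(2, ℤ)) (p : BQF) {q : BQF} (h : q.IsAnisotropic) :
    ∃ c : ℝ, 0 < c ∧
      (BQF.act g p).eval (BQF.act g q).secondRoot = c * p.eval q.secondRoot := by
  obtain ⟨c, hc, e⟩ := eval_act_firstRoot g p h.neg
  refine ⟨c, hc, ?_⟩
  rwa [BQF.act_neg_form, (h.act g).firstRoot_neg, h.firstRoot_neg] at e

/-! ### Root geodesics -/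

/-- The value of a form at a point of the upper half plane. It vanishes on the root geodesic. -/
def BQF.height (q : BQF) (z : ℍ) : ℝ := q.A * (z.re ^ 2 + z.im ^ 2) + q.B * z.re + q.C

theorem BQF.IsAnisotropic.mem_rootGeodesic {q : BQF} (h : q.IsAnisotropic) (z : ℍ) :
    z ∈ q.rootGeodesic ↔ q.height z = 0 := by
  have h2 := h.A_mul_roots_add
  have h3 := h.A_mul_roots_mul
  have hA := h.A_cast_ne_zero
  have hsq : dist (z : ℂ) (((q.secondRoot + q.firstRoot) / 2 : ℝ) : ℂ) ^ 2
      = (z.re - (q.secondRoot + q.firstRoot) / 2) ^ 2 + z.im ^ 2 := by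
    rw [Complex.dist_eq, Complex.sq_norm, Complex.normSq_apply]
    simp only [Complex.sub_re, Complex.sub_im, Complex.ofReal_re, Complex.ofReal_im,
      UpperHalfPlane.coe_re, UpperHalfPlane.coe_im]
    ring
  have hsq' : (|q.secondRoot - q.firstRoot| / 2) ^ 2
      = ((q.secondRoot - q.firstRoot) / 2) ^ 2 := by
    rw [div_pow, sq_abs, div_pow]
  have key : q.height z = q.A * ((z.re - (q.secondRoot + q.firstRoot) / 2) ^ 2 + z.im ^ 2
      - ((q.secondRoot - q.firstRoot) / 2) ^ 2) := by
    simp only [BQF.height]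
    linear_combination z.re * h2 - h3
  rw [key, mul_eq_zero, or_iff_right hA, sub_eq_zero, ← hsq, ← hsq']
  simp only [BQF.rootGeodesic, geodesic, Set.mem_ofPred_eq]
  exact (sq_eq_sq₀ dist_nonneg (by positivity)).symm

theorem height_act (g : SL(2, ℤ)) (q : BQF) (z : ℍ) :
    ∃ c : ℝ, c ≠ 0 ∧ (BQF.act g q).height z = c * q.height (g • z) := by
  have hm : ((g 1 0 : ℝ) * z.re + g 1 1) ^ 2 + ((g 1 0 : ℝ) * z.im) ^ 2 ≠ 0 := by
    intro h0
    have h1 : (g 1 0 : ℝ) * z.im = 0 := by nlinarith [sq_nonneg ((g 1 0 : ℝ) * z.re + g 1 1)]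
    have h2 : (g 1 0 : ℝ) = 0 := (mul_eq_zero.1 h1).resolve_right z.im_pos.ne'
    have h3 : (g 1 1 : ℝ) = 0 := by simpa [h2] using h0
    have hdet := det_eq_one g
    rw [Int.cast_eq_zero.1 h2, Int.cast_eq_zero.1 h3] at hdet
    simp at hdet
  have hco : ((g • z : ℍ) : ℂ) = ((g 0 0 : ℝ) * (z : ℂ) + (g 0 1 : ℝ))
      / ((g 1 0 : ℝ) * (z : ℂ) + (g 1 1 : ℝ)) := by
    rw [UpperHalfPlane.coe_specialLinearGroup_apply]; simp
  have hre : (g • z).re = (((g 0 0 : ℝ) * z.re + g 0 1) * (g 1 0 * z.re + g 1 1)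
      + (g 0 0 * z.im) * (g 1 0 * z.im))
      / (((g 1 0 : ℝ) * z.re + g 1 1) ^ 2 + ((g 1 0 : ℝ) * z.im) ^ 2) := by
    rw [← UpperHalfPlane.coe_re, hco, Complex.div_re, Complex.normSq_apply, ← add_div]
    simp [sq]
  have him : (g • z).re ^ 2 + (g • z).im ^ 2 = (((g 0 0 : ℝ) * z.re + g 0 1) ^ 2
      + (g 0 0 * z.im) ^ 2)
      / (((g 1 0 : ℝ) * z.re + g 1 1) ^ 2 + ((g 1 0 : ℝ) * z.im) ^ 2) := by
    have e : (g • z).re ^ 2 + (g • z).im ^ 2 = Complex.normSq ((g • z : ℍ) : ℂ) := by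
      rw [Complex.normSq_apply, UpperHalfPlane.coe_re, UpperHalfPlane.coe_im]; ring
    rw [e, hco, map_div₀, Complex.normSq_apply, Complex.normSq_apply]
    simp [sq]
  rw [eq_div_iff hm] at hre him
  refine ⟨_, hm, ?_⟩
  simp only [BQF.height, BQF.act]
  push_cast
  linear_combination -(q.A : ℝ) * him - q.B * hre

theorem BQF.IsAnisotropic.mem_rootGeodesic_act {q : BQF} (h : q.IsAnisotropic) (g : SL(2, ℤ))
    (z : ℍ) : z ∈ (BQF.act g q).rootGeodesic ↔ g • z ∈ q.rootGeodesic := by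
  obtain ⟨c, hc, e⟩ := height_act g q z
  rw [(h.act g).mem_rootGeodesic, h.mem_rootGeodesic, e, mul_eq_zero, or_iff_right hc]

theorem BQF.IsAnisotropic.image_rootGeodesic {q : BQF} (h : q.IsAnisotropic) (g : SL(2, ℤ)) :
    (fun z : ℍ => g • z) '' q.rootGeodesic = (BQF.act g⁻¹ q).rootGeodesic := by
  ext z
  rw [h.mem_rootGeodesic_act, Set.mem_image]
  constructor
  · rintro ⟨w, hw, rfl⟩; simpa using hw
  · intro hz; exact ⟨g⁻¹ • z, hz, by simp⟩

/-- There is a point of the root geodesic above every point between the two roots. -/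
theorem BQF.IsAnisotropic.exists_mem_rootGeodesic {q : BQF} (h : q.IsAnisotropic) {x : ℝ}
    (hx : (x - q.firstRoot) * (x - q.secondRoot) < 0) : ∃ z ∈ q.rootGeodesic, z.re = x := by
  have hp : 0 < Real.sqrt (-((x - q.firstRoot) * (x - q.secondRoot))) :=
    Real.sqrt_pos.2 (by linarith)
  refine ⟨⟨⟨x, Real.sqrt (-((x - q.firstRoot) * (x - q.secondRoot)))⟩, hp⟩, ?_, rfl⟩
  rw [h.mem_rootGeodesic]
  have e := h.eval_eq x
  simp only [BQF.eval] at e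
  simp only [BQF.height, UpperHalfPlane.re, UpperHalfPlane.im]
  rw [Real.sq_sqrt (by linarith)]
  linear_combination e

theorem BQF.IsAnisotropic.exists_two_mem_rootGeodesic {q : BQF} (h : q.IsAnisotropic) :
    ∃ z ∈ q.rootGeodesic, ∃ w ∈ q.rootGeodesic, z.re ≠ w.re := by
  have hp : 0 < (q.firstRoot - q.secondRoot) ^ 2 :=
    sq_pos_of_ne_zero (sub_ne_zero.2 h.roots_ne)
  obtain ⟨z, hz, ez⟩ := h.exists_mem_rootGeodesic
    (x := (q.firstRoot + q.secondRoot) / 2) (by nlinarith)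
  obtain ⟨w, hw, ew⟩ := h.exists_mem_rootGeodesic
    (x := (2 * q.firstRoot + q.secondRoot) / 3) (by nlinarith)
  refine ⟨z, hz, w, hw, fun e => h.roots_ne ?_⟩
  rw [ez, ew] at e
  linarith

/-- Two forms are proportional. -/
def BQF.Proportional (p q : BQF) : Prop := q.A * p.B = p.A * q.B ∧ q.A * p.C = p.A * q.C

theorem rootGeodesic_eq_iff {p q : BQF} (hp : p.IsAnisotropic) (hq : q.IsAnisotropic) :
    p.rootGeodesic = q.rootGeodesic ↔ p.Proportional q := by
  constructor
  · intro e
    obtain ⟨z, hz, w, hw, hzw⟩ := hq.exists_two_mem_rootGeodesic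
    have hz' := hz
    have hw' := hw
    rw [← e, hp.mem_rootGeodesic, BQF.height] at hz' hw'
    rw [hq.mem_rootGeodesic, BQF.height] at hz hw
    have h1 : ((q.A : ℝ) * p.B - p.A * q.B) * (z.re - w.re) = 0 := by
      linear_combination q.A * hz' - p.A * hz - q.A * hw' + p.A * hw
    have h2 := (mul_eq_zero.1 h1).resolve_right (sub_ne_zero.2 hzw)
    refine ⟨by exact_mod_cast sub_eq_zero.1 h2, ?_⟩
    have h3 : (q.A : ℝ) * p.C = p.A * q.C := by
      linear_combination q.A * hz' - p.A * hz - z.re * h2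
    exact_mod_cast h3
  · rintro ⟨h1, h2⟩
    have h1' : (q.A : ℝ) * p.B = p.A * q.B := by exact_mod_cast h1
    have h2' : (q.A : ℝ) * p.C = p.A * q.C := by exact_mod_cast h2
    ext z
    rw [hp.mem_rootGeodesic, hq.mem_rootGeodesic]
    have e : q.A * p.height z = p.A * q.height z := by
      simp only [BQF.height]; linear_combination z.re * h1' + h2'
    rw [← mul_eq_zero_iff_left hq.A_cast_ne_zero, e, mul_eq_zero_iff_left hp.A_cast_ne_zero]

/-- A common point of two root geodesics solves two linear equations for `Re z` and `|z|²`. -/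
theorem common_point_equations {p q : BQF} (hp : p.IsAnisotropic) (hq : q.IsAnisotropic) {z : ℍ}
    (hzp : z ∈ p.rootGeodesic) (hzq : z ∈ q.rootGeodesic) :
    ((p.A : ℝ) * q.B - q.A * p.B) * z.re = p.C * q.A - p.A * q.C ∧
      ((p.A : ℝ) * q.B - q.A * p.B) * (z.re ^ 2 + z.im ^ 2) = p.B * q.C - q.B * p.C := by
  rw [hp.mem_rootGeodesic, BQF.height] at hzp
  rw [hq.mem_rootGeodesic, BQF.height] at hzq
  constructor
  · linear_combination p.A * hzq - q.A * hzp
  · linear_combination q.B * hzp - p.B * hzq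

theorem det_ne_zero_of_common_point {p q : BQF} (hp : p.IsAnisotropic) (hq : q.IsAnisotropic)
    {z : ℍ} (hzp : z ∈ p.rootGeodesic) (hzq : z ∈ q.rootGeodesic)
    (hne : p.rootGeodesic ≠ q.rootGeodesic) : (p.A : ℝ) * q.B - q.A * p.B ≠ 0 := by
  intro h0
  refine hne ((rootGeodesic_eq_iff hp hq).2 ?_)
  have h1 := (common_point_equations hp hq hzp hzq).1
  rw [h0, zero_mul] at h1
  refine ⟨?_, ?_⟩
  · have : (q.A : ℝ) * p.B = p.A * q.B := by linarith
    exact_mod_cast this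
  · have : (q.A : ℝ) * p.C = p.A * q.C := by linarith
    exact_mod_cast this

theorem common_point_unique {p q : BQF} (hp : p.IsAnisotropic) (hq : q.IsAnisotropic)
    (hd : (p.A : ℝ) * q.B - q.A * p.B ≠ 0) {z w : ℍ}
    (hzp : z ∈ p.rootGeodesic) (hzq : z ∈ q.rootGeodesic)
    (hwp : w ∈ p.rootGeodesic) (hwq : w ∈ q.rootGeodesic) : z = w := by
  obtain ⟨h1, h2⟩ := common_point_equations hp hq hzp hzq
  obtain ⟨h3, h4⟩ := common_point_equations hp hq hwp hwq
  have e1 : z.re = w.re := mul_left_cancel₀ hd (h1.trans h3.symm)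
  have e2 := mul_left_cancel₀ hd (h2.trans h4.symm)
  rw [e1] at e2
  have e3 : z.im = w.im := by
    have : z.im ^ 2 = w.im ^ 2 := by linarith
    exact (sq_eq_sq₀ z.im_pos.le w.im_pos.le).1 this
  exact UpperHalfPlane.ext_re_im e1 e3

theorem existsUnique_of_common_point {p q : BQF} (hp : p.IsAnisotropic) (hq : q.IsAnisotropic)
    {z : ℍ} (hzp : z ∈ p.rootGeodesic) (hzq : z ∈ q.rootGeodesic)
    (hne : p.rootGeodesic ≠ q.rootGeodesic) :
    ∃! z : ℍ, z ∈ p.rootGeodesic ∧ z ∈ q.rootGeodesic :=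
  ⟨z, ⟨hzp, hzq⟩, fun _ hw => common_point_unique hp hq
    (det_ne_zero_of_common_point hp hq hzp hzq hne) hw.1 hw.2 hzp hzq⟩

theorem rootGeodesic_ne_of_existsUnique {p q : BQF} (hq : q.IsAnisotropic)
    (hu : ∃! z : ℍ, z ∈ p.rootGeodesic ∧ z ∈ q.rootGeodesic) :
    p.rootGeodesic ≠ q.rootGeodesic := by
  intro e
  obtain ⟨z, hz, w, hw, hzw⟩ := hq.exists_two_mem_rootGeodesic
  rw [e] at hu
  exact hzw (congrArg UpperHalfPlane.re (hu.unique ⟨hz, hz⟩ ⟨hw, hw⟩))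

/-- The product of the values of `p` at the two roots of `q` is the resultant of `p` and `q` up
to a square. -/
theorem eval_roots_mul (p : BQF) {q : BQF} (hq : q.IsAnisotropic) :
    (q.A : ℝ) ^ 2 * (p.eval q.firstRoot * p.eval q.secondRoot) =
      (p.C * q.A - p.A * q.C) ^ 2 - (p.A * q.B - q.A * p.B) * (p.B * q.C - q.B * p.C) := by
  have h2 := hq.A_mul_roots_add
  have h3 := hq.A_mul_roots_mul
  have hB : (q.B : ℝ) = -(q.A * (q.firstRoot + q.secondRoot)) := by linarith
  rw [hB, ← h3]
  simp only [BQF.eval]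
  ring

/-- Two root geodesics meet in exactly one point if and only if the roots interlace, i.e. one
form takes values of opposite signs at the roots of the other. -/
theorem existsUnique_common_point_iff {p q : BQF} (hp : p.IsAnisotropic)
    (hq : q.IsAnisotropic) :
    (∃! z : ℍ, z ∈ p.rootGeodesic ∧ z ∈ q.rootGeodesic) ↔
      p.eval q.firstRoot * p.eval q.secondRoot < 0 := by
  have hA : 0 < (q.A : ℝ) ^ 2 := sq_pos_of_ne_zero hq.A_cast_ne_zero
  have hres := eval_roots_mul p hq
  have hiff : p.eval q.firstRoot * p.eval q.secondRoot < 0 ↔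
      (q.A : ℝ) ^ 2 * (p.eval q.firstRoot * p.eval q.secondRoot) < 0 :=
    ⟨mul_neg_of_pos_of_neg hA, fun h => (pos_iff_neg_of_mul_neg h).1 hA⟩
  rw [hiff, hres]
  constructor
  · intro hu
    obtain ⟨z, ⟨hzp, hzq⟩, -⟩ := id hu
    have hd := det_ne_zero_of_common_point hp hq hzp hzq
      (rootGeodesic_ne_of_existsUnique hq hu)
    obtain ⟨h1, h2⟩ := common_point_equations hp hq hzp hzq
    rw [← h1, ← h2]
    have := mul_pos (sq_pos_of_ne_zero hd) (sq_pos_of_ne_zero z.im_pos.ne')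
    nlinarith
  · intro hneg
    set u₁ : ℝ := p.B * q.C - q.B * p.C with hu₁
    set u₂ : ℝ := p.C * q.A - p.A * q.C with hu₂
    set u₃ : ℝ := p.A * q.B - q.A * p.B with hu₃
    have hd : u₃ ≠ 0 := fun h0 => by
      rw [h0, zero_mul] at hneg
      nlinarith [sq_nonneg u₂]
    have hd2 : 0 < u₃ ^ 2 := sq_pos_of_ne_zero hd
    have him : 0 < (u₃ * u₁ - u₂ ^ 2) / u₃ ^ 2 := div_pos (by linarith) hd2
    let z : ℍ := ⟨⟨u₂ / u₃, Real.sqrt ((u₃ * u₁ - u₂ ^ 2) / u₃ ^ 2)⟩, Real.sqrt_pos.2 him⟩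
    have hre : z.re = u₂ / u₃ := rfl
    have hz2 : z.re ^ 2 + z.im ^ 2 = u₁ / u₃ := by
      have : z.im ^ 2 = (u₃ * u₁ - u₂ ^ 2) / u₃ ^ 2 := Real.sq_sqrt him.le
      rw [this, hre]; field_simp; ring
    have hzp : z ∈ p.rootGeodesic := by
      rw [hp.mem_rootGeodesic, BQF.height, hz2, hre]
      field_simp
      rw [hu₁, hu₂, hu₃]; ring
    have hzq : z ∈ q.rootGeodesic := by
      rw [hq.mem_rootGeodesic, BQF.height, hz2, hre]
      field_simp
      rw [hu₁, hu₂, hu₃]; ring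
    exact ⟨z, ⟨hzp, hzq⟩, fun w hw => common_point_unique hp hq hd hw.1 hw.2 hzp hzq⟩

/-- A point lies on the right of a root geodesic if and only if the form is negative there. -/
theorem rightOf_iff_eval_neg {q : BQF} (h : q.IsAnisotropic) (x : ℝ) :
    RightOf q.secondRoot q.firstRoot x ↔ q.eval x < 0 := by
  rw [h.eval_eq, RightOf]
  have h1 := h.A_mul_roots_sub
  have h2 := h.sqrt_disc_pos
  rw [← h1] at h2
  rcases lt_or_gt_of_ne h.A_cast_ne_zero with hA | hA
  · have hr : q.firstRoot < q.secondRoot := by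
      by_contra hc; push Not at hc
      nlinarith
    rw [mul_assoc, mul_neg_iff]
    constructor
    · rintro (⟨h3, -⟩ | ⟨-, h3 | h3⟩)
      · linarith
      · exact Or.inr ⟨hA, mul_pos_of_neg_of_neg (by linarith) (by linarith)⟩
      · exact Or.inr ⟨hA, mul_pos (by linarith) (by linarith)⟩
    · rintro (⟨h3, -⟩ | ⟨-, h3⟩)
      · linarith
      · refine Or.inr ⟨hr, ?_⟩
        rcases mul_pos_iff.1 h3 with h4 | h4
        · exact Or.inr (by linarith)
        · exact Or.inl (by linarith)
  · have hr : q.secondRoot < q.firstRoot := by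
      by_contra hc; push Not at hc
      nlinarith
    rw [mul_assoc, mul_neg_iff]
    constructor
    · rintro (⟨-, h3, h4⟩ | ⟨h3, -⟩)
      · exact Or.inl ⟨hA, mul_neg_of_neg_of_pos (by linarith) (by linarith)⟩
      · linarith
    · rintro (⟨-, h3⟩ | ⟨h3, -⟩)
      · refine Or.inl ⟨hr, ?_⟩
        rcases mul_neg_iff.1 h3 with h4 | h4 <;> constructor <;> linarith
      · linarith

theorem sg_eq_one_iff {p : BQF} (h : p.IsAnisotropic) (q : BQF) :
    BQF.sg p q = 1 ↔ p.eval q.secondRoot < 0 := by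
  rw [BQF.sg, geodesicSign, ← rightOf_iff_eval_neg h]
  split_ifs with hr <;> simp [hr]

theorem sg_eq_neg_one_iff {p : BQF} (h : p.IsAnisotropic) (q : BQF) :
    BQF.sg p q = -1 ↔ 0 ≤ p.eval q.secondRoot := by
  rw [BQF.sg, geodesicSign, ← not_lt, ← rightOf_iff_eval_neg h]
  split_ifs with hr <;> simp [hr]

/-! ### Walking along a river -/

theorem act_L (q : BQF) :
    BQF.act Turn.L.mat q = ⟨q.A, q.B + 2 * q.A, q.A + q.B + q.C⟩ := by
  ext
  · simp [BQF.act, Turn.mat]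
  · simp [BQF.act, Turn.mat]; ring
  · simp [BQF.act, Turn.mat]

theorem act_R (q : BQF) :
    BQF.act Turn.R.mat q = ⟨q.A + q.B + q.C, q.B + 2 * q.C, q.C⟩ := by
  ext <;> simp [BQF.act, Turn.mat]

theorem act_S (q : BQF) : BQF.act matS q = ⟨q.C, -q.B, q.A⟩ := by
  ext <;> simp [BQF.act, matS]

theorem mul_L_entries (g : SL(2, ℤ)) :
    (g * Turn.L.mat) 0 0 = g 0 0 ∧ (g * Turn.L.mat) 0 1 = g 0 0 + g 0 1 ∧
      (g * Turn.L.mat) 1 0 = g 1 0 ∧ (g * Turn.L.mat) 1 1 = g 1 0 + g 1 1 := by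
  refine ⟨?_, ?_, ?_, ?_⟩ <;>
    rw [Matrix.SpecialLinearGroup.coe_mul, Matrix.mul_apply, Fin.sum_univ_two] <;>
    simp [Turn.mat]

theorem mul_R_entries (g : SL(2, ℤ)) :
    (g * Turn.R.mat) 0 0 = g 0 0 + g 0 1 ∧ (g * Turn.R.mat) 0 1 = g 0 1 ∧
      (g * Turn.R.mat) 1 0 = g 1 0 + g 1 1 ∧ (g * Turn.R.mat) 1 1 = g 1 1 := by
  refine ⟨?_, ?_, ?_, ?_⟩ <;>
    rw [Matrix.SpecialLinearGroup.coe_mul, Matrix.mul_apply, Fin.sum_univ_two] <;>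
    simp [Turn.mat]

/-- The form can be read off at an oriented edge of the river, with the flow. -/
def BQF.IsRiverForm (q : BQF) : Prop := 0 < q.A ∧ q.C < 0

/-- Every form is equivalent to one on the river: if `|B|` is minimal in the class, then
`B² ≤ |A C|`, so that `D > 0` forces `A C < 0`. -/
theorem BQF.IsAnisotropic.exists_isRiverForm {q : BQF} (h : q.IsAnisotropic) :
    ∃ g : SL(2, ℤ), (BQF.act g q).IsRiverForm := by
  obtain ⟨g, hg⟩ : ∃ g : SL(2, ℤ), ∀ k : SL(2, ℤ),
      (BQF.act g q).B.natAbs ≤ (BQF.act k q).B.natAbs :=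
    ⟨Function.argmin (fun g : SL(2, ℤ) => (BQF.act g q).B.natAbs),
      fun k => Function.argmin_le (fun g : SL(2, ℤ) => (BQF.act g q).B.natAbs) k⟩
  have hL := hg (g * Turn.L.mat)
  have hL' := hg (g * Turn.L.mat⁻¹)
  have hR := hg (g * Turn.R.mat)
  have hR' := hg (g * Turn.R.mat⁻¹)
  rw [BQF.act_mul g] at hL hL' hR hR'
  have hF := h.act g
  set F := BQF.act g q with hFdef
  have eL' : (BQF.act Turn.L.mat⁻¹ F).B = F.B - 2 * F.A := by
    have e := BQF.act_inv_act Turn.L.mat F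
    rw [act_L, BQF.ext_iff] at e
    obtain ⟨e1, e2, -⟩ := e
    simp only at e1 e2
    omega
  have eR' : (BQF.act Turn.R.mat⁻¹ F).B = F.B - 2 * F.C := by
    have e := BQF.act_inv_act Turn.R.mat F
    rw [act_R, BQF.ext_iff] at e
    obtain ⟨-, e2, e3⟩ := e
    simp only at e2 e3
    omega
  rw [act_L] at hL
  rw [act_R] at hR
  rw [eL'] at hL'
  rw [eR'] at hR'
  simp only at hL hR
  have hA0 := hF.A_ne_zero
  have hC0 := hF.C_ne_zero
  have hBA : |F.B| ≤ |F.A| := by rw [Int.abs_eq_natAbs, Int.abs_eq_natAbs]; omega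
  have hBC : |F.B| ≤ |F.C| := by rw [Int.abs_eq_natAbs, Int.abs_eq_natAbs]; omega
  have hAC : F.A * F.C < 0 := by
    by_contra hc
    push Not at hc
    have h1 : |F.B| * |F.B| ≤ |F.A| * |F.C| :=
      mul_le_mul hBA hBC (abs_nonneg _) (abs_nonneg _)
    rw [abs_mul_abs_self, ← abs_mul, abs_of_nonneg hc] at h1
    have h2 := hF.disc_pos
    simp only [BQF.disc] at h2
    nlinarith
  rcases mul_neg_iff.1 hAC with h1 | h1
  · exact ⟨g, h1⟩
  · refine ⟨g * matS, ?_⟩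
    rw [BQF.act_mul, ← hFdef, act_S]
    exact ⟨h1.2, h1.1⟩

theorem BQF.IsAnisotropic.act_A_eq {q : BQF} (h : q.IsAnisotropic) (g : SL(2, ℤ)) :
    ((BQF.act g q).A : ℝ) =
      q.A * (g 0 0 - q.firstRoot * g 1 0) * (g 0 0 - q.secondRoot * g 1 0) := by
  have h2 := h.A_mul_roots_add
  have h3 := h.A_mul_roots_mul
  simp only [BQF.act]
  push_cast
  linear_combination (g 0 0 : ℝ) * g 1 0 * h2 - (g 1 0 : ℝ) ^ 2 * h3

theorem BQF.IsAnisotropic.act_C_eq {q : BQF} (h : q.IsAnisotropic) (g : SL(2, ℤ)) :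
    ((BQF.act g q).C : ℝ) =
      q.A * (g 0 1 - q.firstRoot * g 1 1) * (g 0 1 - q.secondRoot * g 1 1) := by
  have h2 := h.A_mul_roots_add
  have h3 := h.A_mul_roots_mul
  simp only [BQF.act]
  push_cast
  linear_combination (g 0 1 : ℝ) * g 1 1 * h2 - (g 1 1 : ℝ) ^ 2 * h3

theorem BQF.IsAnisotropic.secondRoot_neg_of_isRiverForm {q : BQF} (h : q.IsAnisotropic)
    (hr : q.IsRiverForm) : q.secondRoot < 0 ∧ 0 < q.firstRoot := by
  have h1 := h.A_mul_roots_sub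
  have h2 := h.sqrt_disc_pos
  have h3 := h.A_mul_roots_mul
  have hA : (0 : ℝ) < q.A := by exact_mod_cast hr.1
  have hC : (q.C : ℝ) < 0 := by exact_mod_cast hr.2
  rw [← h1] at h2
  have h4 : 0 < q.firstRoot - q.secondRoot := pos_of_mul_pos_right h2 hA.le
  rw [← h3] at hC
  have h5 : q.firstRoot * q.secondRoot < 0 := by
    by_contra hc
    push Not at hc
    nlinarith
  rcases mul_neg_iff.1 h5 with h6 | h6
  · exact ⟨h6.2, h6.1⟩
  · linarith

/-- The coefficients of forms on a river are bounded by the discriminant. -/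
theorem BQF.IsRiverForm.bounds {q : BQF} (hr : q.IsRiverForm) :
    q.A ≤ q.disc ∧ |q.B| ≤ q.disc ∧ -q.C ≤ q.disc := by
  obtain ⟨hA, hC⟩ := hr
  have hAC : q.A ≤ -(q.A * q.C) := by nlinarith
  have hAC' : -q.C ≤ -(q.A * q.C) := by nlinarith
  have hB := sq_nonneg q.B
  simp only [BQF.disc]
  refine ⟨by nlinarith, ?_, by nlinarith⟩
  have : |q.B| ≤ q.B ^ 2 := by
    rw [← sq_abs]
    nlinarith [abs_nonneg q.B, Int.le_self_sq |q.B|]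
  nlinarith

/-- The linear form with root `x₂` is comparable on both sides of a river edge of `q`: its values
there are in a bounded ratio, because `q` takes nonzero integral values. -/
theorem BQF.IsAnisotropic.river_edge_comparable {q : BQF} (h : q.IsAnisotropic)
    (hr : q.IsRiverForm) {g : SL(2, ℤ)} (hg : (BQF.act g q).IsRiverForm)
    (ha : 0 < (g 0 0 : ℝ) - q.secondRoot * g 1 0) (hb : 0 < (g 0 1 : ℝ) - q.secondRoot * g 1 1) :
    (g 0 1 : ℝ) - q.secondRoot * g 1 1
        ≤ Real.sqrt q.disc * (g 0 0 - q.secondRoot * g 1 0) ∧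
      (g 0 0 : ℝ) - q.secondRoot * g 1 0
        ≤ Real.sqrt q.disc * (g 0 1 - q.secondRoot * g 1 1) := by
  have hdet : (g 0 0 : ℝ) * g 1 1 - g 0 1 * g 1 0 = 1 := by exact_mod_cast det_eq_one g
  have eA := h.act_A_eq g
  have eC := h.act_C_eq g
  have hA : (1 : ℝ) ≤ (BQF.act g q).A := by exact_mod_cast hg.1
  have hC : ((BQF.act g q).C : ℝ) ≤ -1 := by
    have := hg.2
    exact_mod_cast (by omega : (BQF.act g q).C ≤ -1)
  have hqA : (0 : ℝ) < q.A := by exact_mod_cast hr.1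
  rw [← h.A_mul_roots_sub]
  rw [eA] at hA
  rw [eC] at hC
  set a := (g 0 0 : ℝ) - q.secondRoot * g 1 0 with hadef
  set b := (g 0 1 : ℝ) - q.secondRoot * g 1 1 with hbdef
  set a' := (g 0 0 : ℝ) - q.firstRoot * g 1 0 with hadef'
  set b' := (g 0 1 : ℝ) - q.firstRoot * g 1 1 with hbdef'
  have hrel : a' * b - a * b' = q.firstRoot - q.secondRoot := by
    rw [hadef, hbdef, hadef', hbdef']
    linear_combination (q.firstRoot - q.secondRoot) * hdet
  have ha' : 0 < q.A * a' := by
    by_contra hc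
    push Not at hc
    nlinarith
  have hb' : 0 < -(q.A * b') := by
    by_contra hc
    push Not at hc
    nlinarith
  rw [← hrel]
  constructor
  · have h1 : 0 ≤ (q.A * a' * a - 1) * b := mul_nonneg (by linarith) hb.le
    have h2 : 0 ≤ -(q.A * b') * a * a := by positivity
    nlinarith
  · have h1 : 0 ≤ (-(q.A * b' * b) - 1) * a := mul_nonneg (by linarith) ha.le
    have h2 : 0 ≤ (q.A * a') * b * b := by positivity
    nlinarith

/-- Along the river of `q`, followed with its flow from the edge with the form `q`, the linear form
with root `x₂` grows on both sides at least linearly. -/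
theorem BQF.IsAnisotropic.exists_river_walk {q : BQF} (h : q.IsAnisotropic)
    (hr : q.IsRiverForm) : ∃ W : ℕ → SL(2, ℤ), W 0 = 1 ∧
      (∀ n, W (n + 1) = W n * Turn.L.mat ∨ W (n + 1) = W n * Turn.R.mat) ∧
      (∀ n, (BQF.act (W n) q).IsRiverForm) ∧
      ∃ ε : ℝ, 0 < ε ∧ ∀ n : ℕ,
        ε * (n + 1) ≤ (W n 0 0 : ℝ) - q.secondRoot * W n 1 0 ∧
        ε * (n + 1) ≤ (W n 0 1 : ℝ) - q.secondRoot * W n 1 1 := by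
  classical
  let step : SL(2, ℤ) → SL(2, ℤ) := fun g =>
    if (BQF.act g q).A + (BQF.act g q).B + (BQF.act g q).C < 0 then g * Turn.L.mat
    else g * Turn.R.mat
  let W : ℕ → SL(2, ℤ) := fun n => step^[n] 1
  have hW0 : W 0 = 1 := rfl
  have hWs : ∀ n, W (n + 1) = step (W n) := fun n => Function.iterate_succ_apply' step n 1
  have hriver : ∀ n, (BQF.act (W n) q).IsRiverForm := by
    intro n
    induction n with
    | zero => rw [hW0, BQF.act_one]; exact hr
    | succ n ih =>
      rw [hWs]
      have hne := (h.act (W n)).sum_ne_zero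
      by_cases hs : (BQF.act (W n) q).A + (BQF.act (W n) q).B + (BQF.act (W n) q).C < 0
      · simp only [step, if_pos hs, BQF.act_mul, act_L]
        exact ⟨ih.1, hs⟩
      · simp only [step, if_neg hs, BQF.act_mul, act_R]
        exact ⟨lt_of_le_of_ne (not_lt.1 hs) hne.symm, ih.2⟩
  have hturn : ∀ n, W (n + 1) = W n * Turn.L.mat ∨ W (n + 1) = W n * Turn.R.mat := by
    intro n
    rw [hWs]
    by_cases hs : (BQF.act (W n) q).A + (BQF.act (W n) q).B + (BQF.act (W n) q).C < 0
    · simp [step, if_pos hs]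
    · simp [step, if_neg hs]
  set x := q.secondRoot with hx
  have hx0 : x < 0 := (h.secondRoot_neg_of_isRiverForm hr).1
  -- the smaller of the values of the linear form on the two banks of the initial edge
  let μ : ℝ := min 1 (-x)
  have hμ : 0 < μ := lt_min one_pos (by linarith)
  have hgrow : ∀ n : ℕ, μ ≤ (W n 0 0 : ℝ) - x * W n 1 0 ∧ μ ≤ (W n 0 1 : ℝ) - x * W n 1 1 ∧
      μ * (n + 1) ≤ ((W n 0 0 : ℝ) - x * W n 1 0) + ((W n 0 1 : ℝ) - x * W n 1 1) := by
    intro n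
    induction n with
    | zero =>
      have h1 : μ ≤ 1 := min_le_left _ _
      have h2 : μ ≤ -x := min_le_right _ _
      rw [hW0]
      simp
      refine ⟨h1, h2, by linarith⟩
    | succ n ih =>
      obtain ⟨i1, i2, i3⟩ := ih
      rcases hturn n with e | e
      · obtain ⟨e1, e2, e3, e4⟩ := mul_L_entries (W n)
        rw [e, e1, e2, e3, e4]
        push_cast
        refine ⟨by linarith, by linarith, by linarith⟩
      · obtain ⟨e1, e2, e3, e4⟩ := mul_R_entries (W n)
        rw [e, e1, e2, e3, e4]
        push_cast
        refine ⟨by linarith, by linarith, by linarith⟩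
  refine ⟨W, hW0, hturn, hriver, μ / (1 + Real.sqrt q.disc), ?_, fun n => ?_⟩
  · have := h.sqrt_disc_pos
    positivity
  · have hs := h.sqrt_disc_pos
    obtain ⟨i1, i2, i3⟩ := hgrow n
    obtain ⟨c1, c2⟩ := h.river_edge_comparable hr (hriver n) (hμ.trans_le i1) (hμ.trans_le i2)
    rw [← hx] at c1 c2
    constructor
    · rw [div_mul_eq_mul_div, div_le_iff₀ (by positivity)]
      linarith
    · rw [div_mul_eq_mul_div, div_le_iff₀ (by positivity)]
      linarith

/-- If `p` is positive at the first root of `q`, then `p` is positive at all vectors on which `q` is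
bounded and the linear form with root `x₂` is large. -/
theorem BQF.IsAnisotropic.exists_bound_pos {q : BQF} (h : q.IsAnisotropic) {p : BQF}
    (hp : 0 < p.eval q.firstRoot) (K : ℝ) : ∃ T : ℝ, ∀ X Y : ℝ, 1 ≤ X - q.secondRoot * Y →
      T ≤ X - q.secondRoot * Y →
      |(X - q.firstRoot * Y) * (X - q.secondRoot * Y)| ≤ K →
      0 < p.A * X ^ 2 + p.B * X * Y + p.C * Y ^ 2 := by
  set x₁ := q.firstRoot with hx₁
  set x₂ := q.secondRoot with hx₂
  set P := p.eval x₁ with hP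
  set Q : ℝ := 2 * p.A * x₁ * x₂ + p.B * (x₁ + x₂) + 2 * p.C with hQ
  set R := p.eval x₂ with hR
  refine ⟨(|Q| * K + |R| * K ^ 2 + 1) / P, fun X Y h1 hT hK => ?_⟩
  set a := X - x₂ * Y with ha
  set a' := X - x₁ * Y with ha'
  have hδ : 0 < (x₁ - x₂) ^ 2 := sq_pos_of_ne_zero (sub_ne_zero.2 h.roots_ne)
  -- `p` written as a quadratic form in the two linear forms with roots `x₁` and `x₂`
  have key : (x₁ - x₂) ^ 2 * (p.A * X ^ 2 + p.B * X * Y + p.C * Y ^ 2)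
      = P * a ^ 2 - Q * (a' * a) + R * a' ^ 2 := by
    rw [hP, hQ, hR, ha, ha']
    simp only [BQF.eval]
    ring
  have hK0 : 0 ≤ K := (abs_nonneg _).trans hK
  rw [div_le_iff₀ hp] at hT
  have e1 : Q * (a' * a) ≤ |Q| * K := by
    calc Q * (a' * a) ≤ |Q * (a' * a)| := le_abs_self _
      _ = |Q| * |a' * a| := abs_mul _ _
      _ ≤ |Q| * K := mul_le_mul_of_nonneg_left hK (abs_nonneg _)
  have e2 : a' ^ 2 ≤ K ^ 2 := by
    have hle : |a'| ≤ K := by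
      rw [abs_mul, abs_of_pos (by linarith : 0 < a)] at hK
      exact (le_mul_of_one_le_right (abs_nonneg _) h1).trans hK
    rw [← sq_abs]
    exact pow_le_pow_left₀ (abs_nonneg _) hle 2
  have e3 : -(|R| * K ^ 2) ≤ R * a' ^ 2 := by
    have : |R * a' ^ 2| ≤ |R| * K ^ 2 := by
      rw [abs_mul, abs_of_nonneg (sq_nonneg a')]
      exact mul_le_mul_of_nonneg_left e2 (abs_nonneg _)
    linarith [neg_abs_le (R * a' ^ 2)]
  have e4 : a * P ≤ P * a ^ 2 := by
    have := mul_nonneg (mul_nonneg hp.le (zero_le_one.trans h1)) (sub_nonneg.2 h1)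
    linarith
  have : 0 < (x₁ - x₂) ^ 2 * (p.A * X ^ 2 + p.B * X * Y + p.C * Y ^ 2) := by
    rw [key]; linarith
  exact pos_of_mul_pos_right this hδ.le

/-- Followed far enough, the river of `q` runs through the region where `p` is positive, provided
that `p` is positive at the first root of `q`. -/
theorem BQF.IsAnisotropic.exists_walk_pos {q : BQF} (h : q.IsAnisotropic) (hr : q.IsRiverForm)
    {p : BQF} (hp : 0 < p.eval q.firstRoot) : ∃ W : ℕ → SL(2, ℤ), W 0 = 1 ∧
      (∀ n, W (n + 1) = W n * Turn.L.mat ∨ W (n + 1) = W n * Turn.R.mat) ∧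
      (∀ n, (BQF.act (W n) q).IsRiverForm) ∧
      ∃ n, 0 < (BQF.act (W n) p).A ∧ 0 < (BQF.act (W n) p).C := by
  obtain ⟨W, hW0, hturn, hriver, ε, hε, hgrow⟩ := h.exists_river_walk hr
  refine ⟨W, hW0, hturn, hriver, ?_⟩
  obtain ⟨T, hT⟩ := h.exists_bound_pos hp (q.disc : ℝ)
  obtain ⟨n, hn⟩ := exists_nat_ge (max 1 T / ε)
  have hn' : max 1 T ≤ ε * (n + 1) := by
    rw [div_le_iff₀ hε] at hn
    nlinarith
  have h1 : 1 ≤ ε * (n + 1) := (le_max_left _ _).trans hn'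
  have h2 : T ≤ ε * (n + 1) := (le_max_right _ _).trans hn'
  obtain ⟨g1, g2⟩ := hgrow n
  obtain ⟨b1, -, b2⟩ := (hriver n).bounds
  rw [BQF.disc_act] at b1 b2
  have b1' : ((BQF.act (W n) q).A : ℝ) ≤ q.disc := by exact_mod_cast b1
  have b2' : -((BQF.act (W n) q).C : ℝ) ≤ q.disc := by exact_mod_cast b2
  have s1 : (0 : ℝ) < (BQF.act (W n) q).A := by exact_mod_cast (hriver n).1
  have s2 : ((BQF.act (W n) q).C : ℝ) < 0 := by exact_mod_cast (hriver n).2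
  have hA : (1 : ℝ) ≤ q.A := by exact_mod_cast hr.1
  rw [h.act_A_eq] at b1' s1
  rw [h.act_C_eq] at b2' s2
  refine ⟨n, ?_, ?_⟩
  · have := hT _ _ (h1.trans g1) (h2.trans g1) (by
      rw [mul_assoc] at b1' s1
      have s3 := pos_of_mul_pos_right s1 (by linarith)
      rw [abs_of_pos s3]
      nlinarith)
    have e : ((BQF.act (W n) p).A : ℝ) = p.A * (W n 0 0 : ℝ) ^ 2 + p.B * (W n 0 0 : ℝ) * W n 1 0
        + p.C * (W n 1 0 : ℝ) ^ 2 := by simp [BQF.act]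
    rw [← e] at this
    exact_mod_cast this
  · have := hT _ _ (h1.trans g2) (h2.trans g2) (by
      rw [mul_assoc] at b2' s2
      have s3 := (pos_iff_neg_of_mul_neg s2).1 (by linarith)
      rw [abs_of_neg s3]
      nlinarith)
    have e : ((BQF.act (W n) p).C : ℝ) = p.A * (W n 0 1 : ℝ) ^ 2 + p.B * (W n 0 1 : ℝ) * W n 1 1
        + p.C * (W n 1 1 : ℝ) ^ 2 := by simp [BQF.act]
    rw [← e] at this
    exact_mod_cast this

theorem BQF.IsRiverForm.neg_act_S {q : BQF} (hr : q.IsRiverForm) :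
    (BQF.act matS q).neg.IsRiverForm := by
  rw [act_S]
  exact ⟨by simpa using hr.2, by simpa using hr.1⟩

/-- Backwards, the river of `q` comes from the region where `p` is negative, provided that `p` is
negative at the second root of `q`. -/
theorem BQF.IsAnisotropic.exists_river_edge_neg {q : BQF} (h : q.IsAnisotropic) {p : BQF}
    (hp : p.eval q.secondRoot < 0) : ∃ g : SL(2, ℤ), (BQF.act g q).IsRiverForm ∧
      (BQF.act g p).A < 0 ∧ (BQF.act g p).C < 0 := by
  obtain ⟨k, hk⟩ := h.exists_isRiverForm
  -- The forms `-f ∘ S` describe the same river, followed against its flow.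
  have hQ := (h.act (k * matS)).neg
  have hQr : (BQF.act (k * matS) q).neg.IsRiverForm := by
    rw [BQF.act_mul]; exact hk.neg_act_S
  have hpos : 0 < (BQF.act (k * matS) p).neg.eval (BQF.act (k * matS) q).neg.firstRoot := by
    obtain ⟨c, hc, e⟩ := eval_act_secondRoot (k * matS) p h
    rw [(h.act _).firstRoot_neg, BQF.eval_neg, e]
    nlinarith
  obtain ⟨W, -, -, hriver, n, h1, h2⟩ := hQ.exists_walk_pos hQr hpos
  refine ⟨k * matS * W n * matS, ?_⟩
  have hrn := hriver n
  rw [BQF.act_neg_form, ← BQF.act_mul] at hrn h1 h2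
  rw [BQF.act_mul _ matS, BQF.act_mul _ matS, act_S, act_S]
  simp only [BQF.IsRiverForm, BQF.neg_A, BQF.neg_C] at *
  refine ⟨⟨by omega, by omega⟩, by omega, by omega⟩

/-- If the roots of `p` and `q` interlace suitably, then there is an edge on which the river of `q`
runs into the river of `p`, from the negative side: both regions along the edge are negative for `p`
and the region ahead is positive. -/
theorem BQF.IsAnisotropic.exists_joining_edge {p q : BQF} (hp : p.IsAnisotropic)
    (hq : q.IsAnisotropic) (h2 : p.eval q.secondRoot < 0) (h1 : 0 < p.eval q.firstRoot) :
    ∃ g : SL(2, ℤ), (BQF.act g q).IsRiverForm ∧ (BQF.act g p).A < 0 ∧ (BQF.act g p).C < 0 ∧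
      0 < (BQF.act g p).A + (BQF.act g p).B + (BQF.act g p).C := by
  classical
  obtain ⟨k, hk, hA, hC⟩ := hq.exists_river_edge_neg h2
  have hpos : 0 < (BQF.act k p).eval (BQF.act k q).firstRoot := by
    obtain ⟨c, hc, e⟩ := eval_act_firstRoot k p hq
    rw [e]; positivity
  obtain ⟨W, hW0, hturn, hriver, n, hn, -⟩ := (hq.act k).exists_walk_pos hk hpos
  have hex : ∃ n, ¬((BQF.act (W n) (BQF.act k p)).A < 0 ∧ (BQF.act (W n) (BQF.act k p)).C < 0) :=
    ⟨n, fun hc => by omega⟩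
  -- The edge number `m` of the walk is the last one before `p` ceases to be negative on both banks.
  obtain ⟨m, hm⟩ : ∃ m, Nat.find hex = m + 1 := by
    refine Nat.exists_eq_succ_of_ne_zero fun h0 => ?_
    have := Nat.find_spec hex
    rw [h0, hW0, BQF.act_one] at this
    exact this ⟨hA, hC⟩
  have hspec := Nat.find_spec hex
  have hmin := Nat.find_min hex (m := m) (by omega)
  push Not at hmin
  rw [hm] at hspec
  have hrm := hriver m
  have hne := ((hp.act k).act (W m)).sum_ne_zero
  refine ⟨k * W m, ?_⟩
  simp only [BQF.act_mul k]
  have hmA := hmin.1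
  have hmC := hmin.2
  refine ⟨hrm, hmA, hmC, lt_of_le_of_ne ?_ hne.symm⟩
  by_contra hs
  push Not at hs
  apply hspec
  rcases hturn m with e | e
  · rw [e, BQF.act_mul (W m), act_L]; exact ⟨hmA, hs⟩
  · rw [e, BQF.act_mul (W m), act_R]; exact ⟨hs, hmC⟩

/-- If the rivers of `p` and `q` run through the same edges, then `p` vanishes at the first root of
`q`, for otherwise the river of `q` would run into a region where `p` has a constant sign. -/
theorem BQF.IsAnisotropic.eval_firstRoot_eq_zero {p q : BQF} (hq : q.IsAnisotropic)
    (hov : ∀ g : SL(2, ℤ), (BQF.act g q).IsRiverForm →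
      (BQF.act g p).A * (BQF.act g p).C < 0) : p.eval q.firstRoot = 0 := by
  obtain ⟨k, hk⟩ := hq.exists_isRiverForm
  obtain ⟨c, hc, e⟩ := eval_act_firstRoot k p hq
  by_contra hne
  rcases lt_or_gt_of_ne hne with h0 | h0
  · have hpos : 0 < (BQF.act k p).neg.eval (BQF.act k q).firstRoot := by
      rw [BQF.eval_neg, e]; nlinarith
    obtain ⟨W, -, -, hriver, n, h1, h2⟩ := (hq.act k).exists_walk_pos hk hpos
    have h3 := hov (k * W n) (by rw [BQF.act_mul]; exact hriver n)
    rw [BQF.act_neg_form] at h1 h2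
    simp only [BQF.neg_A, BQF.neg_C] at h1 h2
    rw [BQF.act_mul] at h3
    nlinarith
  · have hpos : 0 < (BQF.act k p).eval (BQF.act k q).firstRoot := by
      rw [e]; positivity
    obtain ⟨W, -, -, hriver, n, h1, h2⟩ := (hq.act k).exists_walk_pos hk hpos
    have h3 := hov (k * W n) (by rw [BQF.act_mul]; exact hriver n)
    rw [BQF.act_mul] at h3
    nlinarith

theorem BQF.IsAnisotropic.proportional_of_eval_firstRoot {p q : BQF} (hq : q.IsAnisotropic)
    (h0 : p.eval q.firstRoot = 0) : p.Proportional q := by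
  have h1 := hq.eval_firstRoot
  simp only [BQF.eval] at h0 h1
  have h2 : ((q.A * p.B - p.A * q.B : ℤ) : ℝ) * q.firstRoot + ((q.A * p.C - p.A * q.C : ℤ) : ℝ)
      = 0 := by
    push_cast
    linear_combination q.A * h0 - p.A * h1
  obtain ⟨h3, h4⟩ := eq_zero_of_irrational hq.irrational_firstRoot h2
  exact ⟨by omega, by omega⟩

/-! ### Oriented edges and the modular group -/

/-- Equality in `PSL(2, ℤ)`. -/
def SignEq (g h : SL(2, ℤ)) : Prop := g = h ∨ g = -h

namespace SignEq

theorem refl (g : SL(2, ℤ)) : SignEq g g := Or.inl rfl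

theorem symm {g h : SL(2, ℤ)} (e : SignEq g h) : SignEq h g := by
  rcases e with rfl | rfl
  · exact Or.inl rfl
  · exact Or.inr (by simp)

theorem trans {g h k : SL(2, ℤ)} (e : SignEq g h) (f : SignEq h k) : SignEq g k := by
  rcases e with rfl | rfl
  · exact f
  · rcases f with rfl | rfl
    · exact Or.inr rfl
    · exact Or.inl (by simp)

theorem mul {g h k l : SL(2, ℤ)} (e : SignEq g h) (f : SignEq k l) :
    SignEq (g * k) (h * l) := by
  rcases e with rfl | rfl <;> rcases f with rfl | rfl
  · exact Or.inl rfl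
  · exact Or.inr (by simp)
  · exact Or.inr (by simp)
  · exact Or.inl (by simp)

theorem act_eq {g h : SL(2, ℤ)} (e : SignEq g h) (q : BQF) : BQF.act g q = BQF.act h q := by
  rcases e with rfl | rfl
  · rfl
  · exact BQF.act_neg_mat h q

end SignEq

theorem matS_mul_matS : matS * matS = -1 := by decide

theorem matL_mul_matS_mul_matL : Turn.L.mat * matS * Turn.L.mat = -Turn.R.mat := by decide

theorem matR_mul_matS_mul_matL : Turn.R.mat * matS * Turn.L.mat = matS := by decide

theorem Dart.rev_rev (d : Dart) : d.rev.rev = d := by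
  rcases d with ⟨⟨b, _ | ⟨t, w⟩⟩, _ | _ | _⟩
  · simp [Dart.rev]
  · simp [Dart.rev, Turn.slot]
  · simp [Dart.rev, Turn.slot]
  · cases t <;> simp [Dart.rev, Turn.slot]
  · simp [Dart.rev, Turn.slot]
  · simp [Dart.rev, Turn.slot]

theorem Dart.leftTurn_rev_leftTurn (d : Dart) : d.leftTurn.rev.leftTurn = d.rightTurn := by
  have e : d.leftTurn.rev = ⟨d.vertex, d.slot.clockwise⟩ := Dart.rev_rev _
  rw [e]
  rfl

theorem Dart.mat_rev (d : Dart) : SignEq d.rev.mat (d.mat * matS) := by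
  rcases d with ⟨⟨b, _ | ⟨t, w⟩⟩, _ | _ | _⟩
  · cases b
    · exact Or.inr (by simp [Dart.rev, Dart.mat, routeMat, matS_mul_matS])
    · exact Or.inl (by simp [Dart.rev, Dart.mat, routeMat])
  · exact Or.inr (by simp [Dart.rev, Dart.mat, mul_assoc, matS_mul_matS])
  · exact Or.inr (by simp [Dart.rev, Dart.mat, mul_assoc, matS_mul_matS])
  · cases t <;> exact Or.inl rfl
  · exact Or.inr (by simp [Dart.rev, Dart.mat, mul_assoc, matS_mul_matS])
  · exact Or.inr (by simp [Dart.rev, Dart.mat, mul_assoc, matS_mul_matS])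

theorem routeMat_cons (b : Bool) (t : Turn) (w : List Turn) :
    routeMat b (t :: w) = routeMat b w * t.mat := by
  cases b <;> rfl

theorem Dart.mat_leftTurn (d : Dart) : SignEq d.leftTurn.mat (d.mat * Turn.L.mat) := by
  rcases d with ⟨⟨b, w⟩, _ | _ | _⟩
  · refine Or.inl ?_
    have : (⟨⟨b, w⟩, .back⟩ : Dart).leftTurn = ⟨⟨b, .L :: w⟩, .back⟩ := by
      cases w <;> rfl
    rw [this]
    simp only [Dart.mat, routeMat_cons]
  · refine Or.inr ?_
    have : (⟨⟨b, w⟩, .left⟩ : Dart).leftTurn = ⟨⟨b, .R :: w⟩, .back⟩ := by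
      cases w <;> rfl
    rw [this]
    simp only [Dart.mat, routeMat_cons]
    rw [mul_assoc, mul_assoc, ← mul_assoc Turn.L.mat, matL_mul_matS_mul_matL]
    simp
  · have : (⟨⟨b, w⟩, .right⟩ : Dart).leftTurn = (⟨⟨b, w⟩, .back⟩ : Dart).rev := rfl
    rw [this]
    refine (Dart.mat_rev _).trans (Or.inl ?_)
    simp only [Dart.mat, routeMat_cons]
    rw [mul_assoc, mul_assoc, ← mul_assoc Turn.R.mat, matR_mul_matS_mul_matL]

theorem Dart.mat_rightTurn (d : Dart) : SignEq d.rightTurn.mat (d.mat * Turn.R.mat) := by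
  rw [← Dart.leftTurn_rev_leftTurn]
  refine (Dart.mat_leftTurn _).trans ?_
  refine ((((Dart.mat_rev _).trans ((Dart.mat_leftTurn d).mul (SignEq.refl _)))).mul
    (SignEq.refl Turn.L.mat)).trans (Or.inr ?_)
  rw [mul_assoc, mul_assoc, ← mul_assoc Turn.L.mat, matL_mul_matS_mul_matL]
  simp

/-- Every element of `PSL(2, ℤ)` belongs to an oriented edge, since `S` and `T` generate. -/
theorem Dart.exists_mat (g : SL(2, ℤ)) : ∃ d : Dart, SignEq d.mat g := by
  have hg : g ∈ Subgroup.closure {ModularGroup.S, ModularGroup.T} := by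
    rw [SpecialLinearGroup.SL2Z_generators]; trivial
  have hS : ∀ x : SL(2, ℤ), ∀ y : SL(2, ℤ), SignEq y matS → (∃ d : Dart, SignEq d.mat x) →
      ∃ d : Dart, SignEq d.mat (x * y) := by
    rintro x y hy ⟨d, hd⟩
    exact ⟨d.rev, d.mat_rev.trans (hd.mul hy.symm)⟩
  induction hg using Subgroup.closure_induction_right with
  | one => exact ⟨⟨⟨true, []⟩, .back⟩, Or.inl rfl⟩
  | mul_right x hx y hy ih =>
    rcases hy with rfl | rfl
    · exact hS x _ (Or.inr (by decide)) ih
    · obtain ⟨d, hd⟩ := ih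
      refine ⟨d.leftTurn, d.mat_leftTurn.trans (hd.mul (Or.inl (by decide)))⟩
  | mul_inv_cancel x hx y hy ih =>
    rcases hy with rfl | rfl
    · exact hS x _ (Or.inl (by decide)) ih
    · obtain ⟨d, hd⟩ := ih
      -- `T⁻¹ = S R S⁻¹`
      refine ⟨d.rev.rightTurn.rev, (Dart.mat_rev _).trans ((((Dart.mat_rightTurn _).trans
        ((d.mat_rev.trans (hd.mul (SignEq.refl _))).mul (SignEq.refl _))).mul
        (SignEq.refl _)).trans (Or.inr ?_))⟩
      have : matS * Turn.R.mat * matS = -ModularGroup.T⁻¹ := by decide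
      rw [mul_assoc, mul_assoc, ← mul_assoc matS, this]
      simp

/-- All entries are nonnegative. -/
def EntriesNonneg (g : SL(2, ℤ)) : Prop := ∀ i j, 0 ≤ g i j

theorem entriesNonneg_routeMat (w : List Turn) : EntriesNonneg (routeMat true w) := by
  induction w with
  | nil => simp [EntriesNonneg, routeMat, Fin.forall_fin_two]
  | cons t w ih =>
    simp only [EntriesNonneg, Fin.forall_fin_two] at ih ⊢
    obtain ⟨⟨h1, h2⟩, h3, h4⟩ := ih
    rw [routeMat_cons]
    cases t
    · obtain ⟨e1, e2, e3, e4⟩ := mul_L_entries (routeMat true w)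
      rw [e1, e2, e3, e4]
      refine ⟨⟨?_, ?_⟩, ?_, ?_⟩ <;> omega
    · obtain ⟨e1, e2, e3, e4⟩ := mul_R_entries (routeMat true w)
      rw [e1, e2, e3, e4]
      refine ⟨⟨?_, ?_⟩, ?_, ?_⟩ <;> omega

/-- After a left turn the second column dominates the first one, after a right turn it is the other
way round. -/
theorem routeMat_L_ne_R {g h : SL(2, ℤ)} (hg : EntriesNonneg g) (hh : EntriesNonneg h) :
    g * Turn.L.mat ≠ h * Turn.R.mat := by
  intro e
  obtain ⟨e1, e2, e3, e4⟩ := mul_L_entries g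
  obtain ⟨f1, f2, f3, f4⟩ := mul_R_entries h
  rw [e] at e1 e2 e3 e4
  have hdet := det_eq_one g
  have a1 := hg 0 1
  have a2 := hg 1 1
  have a3 := hh 0 0
  have a4 := hh 1 0
  have z1 : g 0 1 = 0 := by omega
  have z2 : g 1 1 = 0 := by omega
  rw [z1, z2] at hdet
  simp at hdet

theorem routeMat_ne_one (t : Turn) (w : List Turn) : routeMat true (t :: w) ≠ 1 := by
  intro e
  have hn := entriesNonneg_routeMat w
  rw [routeMat_cons] at e
  cases t
  · obtain ⟨e1, e2, e3, e4⟩ := mul_L_entries (routeMat true w)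
    rw [e] at e1 e2
    have := hn 0 1
    simp at e1 e2
    omega
  · obtain ⟨e1, e2, e3, e4⟩ := mul_R_entries (routeMat true w)
    rw [e] at e3 e4
    have := hn 1 0
    simp at e3 e4
    omega

/-- `L` and `R` generate a free monoid. -/
theorem routeMat_injective {w w' : List Turn} (h : routeMat true w = routeMat true w') :
    w = w' := by
  induction w generalizing w' with
  | nil =>
    cases w' with
    | nil => rfl
    | cons t w' => exact absurd h.symm (routeMat_ne_one t w')
  | cons t w ih =>
    cases w' with
    | nil => exact absurd h (routeMat_ne_one t w)
    | cons t' w' =>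
      rw [routeMat_cons, routeMat_cons] at h
      have hn := entriesNonneg_routeMat w
      have hn' := entriesNonneg_routeMat w'
      cases t <;> cases t'
      · rw [ih (mul_right_cancel h)]
      · exact absurd h (routeMat_L_ne_R hn hn')
      · exact absurd h.symm (routeMat_L_ne_R hn' hn)
      · rw [ih (mul_right_cancel h)]

theorem mul_S_entries (g : SL(2, ℤ)) :
    (g * matS) 0 0 = -g 0 1 ∧ (g * matS) 0 1 = g 0 0 ∧
      (g * matS) 1 0 = -g 1 1 ∧ (g * matS) 1 1 = g 1 0 := by
  refine ⟨?_, ?_, ?_, ?_⟩ <;>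
    rw [Matrix.SpecialLinearGroup.coe_mul, Matrix.mul_apply, Fin.sum_univ_two] <;>
    simp [matS]

theorem S_mul_entries (g : SL(2, ℤ)) :
    (matS * g) 0 0 = g 1 0 ∧ (matS * g) 0 1 = g 1 1 ∧
      (matS * g) 1 0 = -g 0 0 ∧ (matS * g) 1 1 = -g 0 1 := by
  refine ⟨?_, ?_, ?_, ?_⟩ <;>
    rw [Matrix.SpecialLinearGroup.coe_mul, Matrix.mul_apply, Fin.sum_univ_two] <;>
    simp [matS]

theorem neg_entries (g : SL(2, ℤ)) (i j : Fin 2) : (-g) i j = -g i j := by simp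

theorem EntriesNonneg.eq_of_signEq {g h : SL(2, ℤ)} (hg : EntriesNonneg g)
    (hh : EntriesNonneg h) (e : SignEq g h) : g = h := by
  rcases e with e | e
  · exact e
  · exfalso
    have h1 := hg 0 0
    have h2 := hg 0 1
    have h3 := hh 0 0
    have h4 := hh 0 1
    have hdet := det_eq_one g
    rw [e] at h1 h2 hdet
    simp only [neg_entries] at h1 h2 hdet
    rw [(by omega : h 0 0 = 0), (by omega : h 0 1 = 0)] at hdet
    simp at hdet

theorem EntriesNonneg.not_signEq_mul_S {g h : SL(2, ℤ)} (hg : EntriesNonneg g)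
    (hh : EntriesNonneg h) : ¬SignEq g (h * matS) := by
  obtain ⟨e1, e2, e3, e4⟩ := mul_S_entries h
  have hdet := det_eq_one g
  have g1 := hg 0 0
  have g2 := hg 0 1
  have g3 := hg 1 0
  have g4 := hg 1 1
  have h1 := hh 0 0
  have h2 := hh 0 1
  have h3 := hh 1 0
  have h4 := hh 1 1
  rintro (rfl | rfl)
  · rw [(by omega : (h * matS) 0 0 = 0), (by omega : (h * matS) 1 0 = 0)] at hdet
    simp at hdet
  · simp only [neg_entries] at *
    rw [(by omega : (h * matS) 0 1 = 0), (by omega : (h * matS) 1 1 = 0)] at hdet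
    simp at hdet

theorem EntriesNonneg.not_signEq_S_mul {g h : SL(2, ℤ)} (hg : EntriesNonneg g)
    (hh : EntriesNonneg h) : ¬SignEq g (matS * h) := by
  obtain ⟨e1, e2, e3, e4⟩ := S_mul_entries h
  have hdet := det_eq_one g
  have g1 := hg 0 0
  have g2 := hg 0 1
  have g3 := hg 1 0
  have g4 := hg 1 1
  have h1 := hh 0 0
  have h2 := hh 0 1
  have h3 := hh 1 0
  have h4 := hh 1 1
  rintro (rfl | rfl)
  · rw [(by omega : (matS * h) 1 0 = 0), (by omega : (matS * h) 1 1 = 0)] at hdet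
    simp at hdet
  · simp only [neg_entries] at *
    rw [(by omega : (matS * h) 0 0 = 0), (by omega : (matS * h) 0 1 = 0)] at hdet
    simp at hdet

theorem EntriesNonneg.eq_one_of_signEq {g h : SL(2, ℤ)} (hg : EntriesNonneg g)
    (hh : EntriesNonneg h) (e : SignEq (g * matS) (matS * h)) : g = 1 ∧ h = 1 := by
  obtain ⟨e1, e2, e3, e4⟩ := S_mul_entries h
  obtain ⟨f1, f2, f3, f4⟩ := mul_S_entries g
  have hdet := det_eq_one g
  have g1 := hg 0 0
  have g2 := hg 0 1
  have g3 := hg 1 0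
  have g4 := hg 1 1
  have h1 := hh 0 0
  have h2 := hh 0 1
  have h3 := hh 1 0
  have h4 := hh 1 1
  rcases e with e | e
  · rw [e] at f1 f2 f3 f4
    have z1 : g 0 1 = 0 := by omega
    have z2 : g 1 0 = 0 := by omega
    rw [z1, z2] at hdet
    have u := Int.eq_one_or_neg_one_of_mul_eq_one (by simpa using hdet : g 0 0 * g 1 1 = 1)
    have u1 : g 0 0 = 1 := by omega
    have u2 : g 1 1 = 1 := by rw [u1] at hdet; omega
    constructor <;> ext i j <;> fin_cases i <;> fin_cases j <;> simp <;> omega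
  · rw [e] at f1 f2 f3 f4
    simp only [neg_entries] at f1 f2 f3 f4
    exfalso
    rw [(by omega : g 0 0 = 0), (by omega : g 1 1 = 0)] at hdet
    nlinarith

/-- The data of an oriented edge in a normal form, in which its matrix is `S^{0,1} w S^{0,1}` with
a positive word `w` in `L` and `R`. -/
def Dart.code : Dart → Bool × List Turn × Bool
  | ⟨⟨b, w⟩, .back⟩ => (b, w, false)
  | ⟨⟨b, w⟩, .left⟩ => (b, .L :: w, true)
  | ⟨⟨b, w⟩, .right⟩ => (b, .R :: w, true)

theorem Dart.code_injective {d d' : Dart} (h : d.code = d'.code) : d = d' := by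
  rcases d with ⟨⟨b, w⟩, _ | _ | _⟩ <;> rcases d' with ⟨⟨b', w'⟩, _ | _ | _⟩ <;>
    simp_all [Dart.code]

theorem routeMat_eq (b : Bool) (w : List Turn) :
    routeMat b w = (if b then 1 else matS) * routeMat true w := by
  induction w with
  | nil => cases b <;> simp [routeMat]
  | cons t w ih => rw [routeMat_cons, routeMat_cons, ih, mul_assoc]

theorem Dart.mat_eq (d : Dart) : d.mat = (if d.code.1 then 1 else matS) *
    routeMat true d.code.2.1 * (if d.code.2.2 then matS else 1) := by
  rcases d with ⟨⟨b, w⟩, _ | _ | _⟩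
  · exact (routeMat_eq b w).trans (mul_one _).symm
  · exact congrArg (· * matS) (routeMat_eq b (.L :: w))
  · exact congrArg (· * matS) (routeMat_eq b (.R :: w))

theorem Dart.code_ne_nil (d : Dart) (h : d.code.2.2 = true) :
    ∃ t w, d.code.2.1 = t :: w := by
  rcases d with ⟨⟨b, w⟩, _ | _ | _⟩ <;> simp_all [Dart.code]

theorem SignEq.mul_left_cancel {g h k : SL(2, ℤ)} (e : SignEq (k * g) (k * h)) :
    SignEq g h := by
  simpa using (SignEq.refl k⁻¹).mul e

theorem SignEq.mul_right_cancel {g h k : SL(2, ℤ)} (e : SignEq (g * k) (h * k)) :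
    SignEq g h := by
  simpa using e.mul (SignEq.refl k⁻¹)

/-- Different oriented edges belong to different elements of `PSL(2, ℤ)`. For a
matrix `w` with nonnegative entries, `± w S` and `± S w` are never of this kind, and `± S w S` only
if `w = 1`; hence the two outer letters of the normal form can be recovered. -/
theorem Dart.mat_injective {d d' : Dart} (h : SignEq d.mat d'.mat) : d = d' := by
  apply Dart.code_injective
  have hd := d.code_ne_nil
  have hd' := d'.code_ne_nil
  rw [d.mat_eq, d'.mat_eq] at h
  generalize d.code = c at *
  generalize d'.code = c' at *
  obtain ⟨b, u, e⟩ := c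
  obtain ⟨b', u', e'⟩ := c'
  simp only at hd hd' h ⊢
  have hn := entriesNonneg_routeMat u
  have hn' := entriesNonneg_routeMat u'
  have hSS : SignEq (matS * matS) 1 := Or.inr matS_mul_matS
  have hu : ∀ {b : Bool} {v : List Turn}, (b = true → ∃ t w, v = t :: w) → b = true →
      routeMat true v ≠ 1 := by
    intro b v hv hb
    obtain ⟨t, w, rfl⟩ := hv hb
    exact routeMat_ne_one t w
  rcases b <;> rcases b' <;> rcases e <;> rcases e' <;>
    simp only [if_true, if_false, one_mul, mul_one, Bool.false_eq_true] at h
  -- both on the side `false`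
  · rw [routeMat_injective (hn.eq_of_signEq hn' h.mul_left_cancel)]
  · rw [mul_assoc] at h
    exact absurd h.mul_left_cancel (hn.not_signEq_mul_S hn')
  · rw [mul_assoc] at h
    exact absurd h.mul_left_cancel.symm (hn'.not_signEq_mul_S hn)
  · rw [routeMat_injective (hn.eq_of_signEq hn' h.mul_right_cancel.mul_left_cancel)]
  -- on different sides
  · exact absurd h.symm (hn'.not_signEq_S_mul hn)
  · exact absurd (hn'.eq_one_of_signEq hn h.symm).1 (hu hd' rfl)
  · have h2 := (SignEq.refl matS).mul h
    rw [mul_assoc, ← mul_assoc matS matS] at h2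
    have h3 := ((hSS.symm.mul (SignEq.refl (routeMat true u * matS))).trans h2)
    rw [one_mul] at h3
    exact absurd (hn.eq_one_of_signEq hn' h3).1 (hu hd rfl)
  · exact absurd h.mul_right_cancel.symm (hn'.not_signEq_S_mul hn)
  · exact absurd h (hn.not_signEq_S_mul hn')
  · have h2 := (SignEq.refl matS).mul h.symm
    rw [mul_assoc, ← mul_assoc matS matS] at h2
    have h3 := ((hSS.symm.mul (SignEq.refl (routeMat true u' * matS))).trans h2)
    rw [one_mul] at h3
    exact absurd (hn'.eq_one_of_signEq hn h3).1 (hu hd' rfl)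
  · exact absurd (hn.eq_one_of_signEq hn' h).1 (hu hd rfl)
  · exact absurd h.mul_right_cancel (hn.not_signEq_S_mul hn')
  -- both on the side `true`
  · rw [routeMat_injective (hn.eq_of_signEq hn' h)]
  · exact absurd h (hn.not_signEq_mul_S hn')
  · exact absurd h.symm (hn'.not_signEq_mul_S hn)
  · rw [routeMat_injective (hn.eq_of_signEq hn' h.mul_right_cancel)]

/-! ### Automorphisms of the plane tree and the modular group -/

/-- The automorphism `φ` of the plane tree is the left multiplication with `σ` when oriented edges
are regarded as elements of `PSL(2, ℤ)`. -/
def InducedBy (φ : planeAut) (σ : SL(2, ℤ)) : Prop := ∀ d, SignEq (φ.1 d).mat (σ * d.mat)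

theorem planeAut_rev (φ : planeAut) (d : Dart) : φ.1 d.rev = (φ.1 d).rev := φ.2.1 d

theorem planeAut_leftTurn (φ : planeAut) (d : Dart) : φ.1 d.leftTurn = (φ.1 d).leftTurn :=
  φ.2.2 d

/-- Every automorphism of the plane tree comes from the modular group. -/
theorem exists_inducedBy (φ : planeAut) : ∃ σ, InducedBy φ σ := by
  refine ⟨(φ.1 ⟨⟨true, []⟩, .back⟩).mat, ?_⟩
  set σ := (φ.1 ⟨⟨true, []⟩, .back⟩).mat with hσ
  have hrev : ∀ d, SignEq (φ.1 d).mat (σ * d.mat) → SignEq (φ.1 d.rev).mat (σ * d.rev.mat) := by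
    intro d hd
    rw [planeAut_rev]
    refine (Dart.mat_rev _).trans ((hd.mul (SignEq.refl matS)).trans ?_)
    rw [mul_assoc]
    exact (SignEq.refl σ).mul d.mat_rev.symm
  have hL : ∀ d, SignEq (φ.1 d).mat (σ * d.mat) →
      SignEq (φ.1 d.leftTurn).mat (σ * d.leftTurn.mat) := by
    intro d hd
    rw [planeAut_leftTurn]
    refine (Dart.mat_leftTurn _).trans ((hd.mul (SignEq.refl Turn.L.mat)).trans ?_)
    rw [mul_assoc]
    exact (SignEq.refl σ).mul d.mat_leftTurn.symm
  have hback : ∀ b w, SignEq (φ.1 ⟨⟨b, w⟩, .back⟩).mat (σ * (⟨⟨b, w⟩, .back⟩ : Dart).mat) := by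
    intro b w
    induction w with
    | nil =>
      have h0 : SignEq (φ.1 ⟨⟨true, []⟩, .back⟩).mat
          (σ * (⟨⟨true, []⟩, .back⟩ : Dart).mat) := Or.inl (by simp [Dart.mat, routeMat, hσ])
      cases b
      · exact hrev _ h0
      · exact h0
    | cons t w ih =>
      cases t
      · have e : (⟨⟨b, .L :: w⟩, .back⟩ : Dart) = (⟨⟨b, w⟩, .back⟩ : Dart).leftTurn := by
          cases w <;> rfl
        rw [e]
        exact hL _ ih
      · have e : (⟨⟨b, .R :: w⟩, .back⟩ : Dart) = (⟨⟨b, w⟩, .back⟩ : Dart).rightTurn := by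
          cases w <;> rfl
        rw [e, ← Dart.leftTurn_rev_leftTurn]
        exact hL _ (hrev _ (hL _ ih))
  rintro ⟨⟨b, w⟩, _ | _ | _⟩
  · exact hback b w
  · have e : (⟨⟨b, w⟩, .left⟩ : Dart) = (⟨⟨b, .L :: w⟩, .back⟩ : Dart).rev := rfl
    rw [e]
    exact hrev _ (hback _ _)
  · have e : (⟨⟨b, w⟩, .right⟩ : Dart) = (⟨⟨b, .R :: w⟩, .back⟩ : Dart).rev := rfl
    rw [e]
    exact hrev _ (hback _ _)

/-- Every element of the modular group acts on the plane tree. -/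
theorem exists_planeAut (σ : SL(2, ℤ)) : ∃ φ, InducedBy φ σ := by
  choose D hD using Dart.exists_mat
  have hinv : ∀ (g h : SL(2, ℤ)) (d : Dart), h * g = 1 → D (h * (D (g * d.mat)).mat) = d := by
    intro g h d e
    refine Dart.mat_injective ((hD _).trans (((SignEq.refl h).mul (hD _)).trans (Or.inl ?_)))
    rw [← mul_assoc, e, one_mul]
  let f : Equiv.Perm Dart :=
    { toFun := fun d => D (σ * d.mat)
      invFun := fun d => D (σ⁻¹ * d.mat)
      left_inv := fun d => hinv σ σ⁻¹ d (inv_mul_cancel σ)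
      right_inv := fun d => hinv σ⁻¹ σ d (mul_inv_cancel σ) }
  have hf : ∀ d, SignEq (f d).mat (σ * d.mat) := fun d => hD _
  refine ⟨⟨f, fun d => Dart.mat_injective ?_, fun d => Dart.mat_injective ?_⟩, hf⟩
  · refine (hf _).trans (((SignEq.refl σ).mul d.mat_rev).trans ?_)
    rw [← mul_assoc]
    exact ((hf d).symm.mul (SignEq.refl _)).trans (Dart.mat_rev _).symm
  · refine (hf _).trans (((SignEq.refl σ).mul d.mat_leftTurn).trans ?_)
    rw [← mul_assoc]
    exact ((hf d).symm.mul (SignEq.refl _)).trans (Dart.mat_leftTurn _).symm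

namespace InducedBy

theorem mul {φ ψ : planeAut} {σ τ : SL(2, ℤ)} (h : InducedBy φ σ) (k : InducedBy ψ τ) :
    InducedBy (φ * ψ) (σ * τ) := fun d => by
  rw [mul_assoc]
  exact (h _).trans ((SignEq.refl σ).mul (k d))

theorem signEq {φ : planeAut} {σ τ : SL(2, ℤ)} (h : InducedBy φ σ) (k : InducedBy φ τ) :
    SignEq σ τ := by
  have e := (h ⟨⟨true, []⟩, .back⟩).symm.trans (k ⟨⟨true, []⟩, .back⟩)
  exact e.mul_right_cancel

/-- Automorphisms of the plane tree that agree on one oriented edge are equal. -/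
theorem eq_of_apply_eq {φ ψ : planeAut} {d : Dart} (e : φ.1 d = ψ.1 d) : φ = ψ := by
  obtain ⟨σ, hσ⟩ := exists_inducedBy φ
  obtain ⟨τ, hτ⟩ := exists_inducedBy ψ
  have h1 := hσ d
  rw [e] at h1
  have h2 : SignEq σ τ := (h1.symm.trans (hτ d)).mul_right_cancel
  refine Subtype.ext (Equiv.ext fun d' => Dart.mat_injective ?_)
  exact (hσ d').trans ((h2.mul (SignEq.refl _)).trans (hτ d').symm)

theorem eq {φ ψ : planeAut} {σ : SL(2, ℤ)} (h : InducedBy φ σ) (k : InducedBy ψ σ) : φ = ψ :=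
  eq_of_apply_eq (d := ⟨⟨true, []⟩, .back⟩)
    (Dart.mat_injective ((h _).trans (k _).symm))

end InducedBy

/-! ### Crossing rivers -/

theorem topograph_rev (q : BQF) (d : Dart) :
    topograph q d.rev = ⟨(topograph q d).C, -(topograph q d).B, (topograph q d).A⟩ := by
  rw [topograph, d.mat_rev.act_eq, BQF.act_mul, act_S]; rfl

theorem topograph_leftTurn (q : BQF) (d : Dart) :
    topograph q d.leftTurn = ⟨(topograph q d).A, (topograph q d).B + 2 * (topograph q d).A,
      (topograph q d).A + (topograph q d).B + (topograph q d).C⟩ := by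
  rw [topograph, d.mat_leftTurn.act_eq, BQF.act_mul, act_L]; rfl

theorem topograph_rightTurn (q : BQF) (d : Dart) :
    topograph q d.rightTurn = ⟨(topograph q d).A + (topograph q d).B + (topograph q d).C,
      (topograph q d).B + 2 * (topograph q d).C, (topograph q d).C⟩ := by
  rw [topograph, d.mat_rightTurn.act_eq, BQF.act_mul, act_R]; rfl

theorem exists_topograph_eq (g : SL(2, ℤ)) :
    ∃ d : Dart, ∀ q : BQF, topograph q d = BQF.act g q := by
  obtain ⟨d, hd⟩ := Dart.exists_mat g
  exact ⟨d, fun q => hd.act_eq q⟩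

/-- Superimposing the topograph of `q` by means of `σ` gives the topograph of `σ⁻¹ ∘ q`. -/
theorem InducedBy.topograph_eq {φ : planeAut} {σ : SL(2, ℤ)} (h : InducedBy φ σ) (q : BQF)
    (d : Dart) : topograph (BQF.act σ⁻¹ q) (φ.1 d) = topograph q d := by
  rw [topograph, (h d).act_eq, BQF.act_mul, BQF.act_inv_act]; rfl

theorem InducedBy.superimposedRiver_eq {φ : planeAut} {σ : SL(2, ℤ)} (h : InducedBy φ σ)
    (q : BQF) : superimposedRiver q φ = river (BQF.act σ⁻¹ q) := by
  ext d
  obtain ⟨d, rfl⟩ := φ.1.surjective d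
  rw [superimposedRiver, φ.1.injective.mem_set_image]
  simp only [river, Set.mem_ofPred_eq, h.topograph_eq]

theorem joinsFromRight_iff (p q : BQF) : JoinsFromRight (river p) (river q) ↔
    ∃ g : SL(2, ℤ), (BQF.act g p).IsRiverForm ∧
      (BQF.act g p).A + (BQF.act g p).B + (BQF.act g p).C < 0 ∧
      0 < (BQF.act g q).C ∧ (BQF.act g q).A + (BQF.act g q).B + (BQF.act g q).C < 0 := by
  simp only [JoinsFromRight, river, Set.mem_ofPred_eq, topograph_rev, topograph_leftTurn,
    topograph_rightTurn]
  constructor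
  · rintro ⟨d, h1, h2, h3⟩
    exact ⟨d.mat, h1, h2.2, h3⟩
  · rintro ⟨g, h1, h2, h3⟩
    obtain ⟨d, hd⟩ := exists_topograph_eq g
    refine ⟨d, ?_⟩
    rw [hd, hd]
    exact ⟨h1, ⟨h1.1, h2⟩, h3⟩

theorem joinsFromLeft_iff (p q : BQF) : JoinsFromLeft (river p) (river q) ↔
    ∃ g : SL(2, ℤ), (BQF.act g p).IsRiverForm ∧
      0 < (BQF.act g p).A + (BQF.act g p).B + (BQF.act g p).C ∧
      0 < (BQF.act g q).A + (BQF.act g q).B + (BQF.act g q).C ∧ (BQF.act g q).A < 0 := by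
  simp only [JoinsFromLeft, river, Set.mem_ofPred_eq, topograph_rev, topograph_leftTurn,
    topograph_rightTurn]
  constructor
  · rintro ⟨d, h1, h2, h3⟩
    exact ⟨d.mat, h1, h2.1, h3⟩
  · rintro ⟨g, h1, h2, h3⟩
    obtain ⟨d, hd⟩ := exists_topograph_eq g
    refine ⟨d, ?_⟩
    rw [hd, hd]
    exact ⟨h1, ⟨h2, h1.2⟩, h3⟩

theorem leavesToRight_iff (p q : BQF) : LeavesToRight (river p) (river q) ↔
    ∃ g : SL(2, ℤ), (BQF.act g p).IsRiverForm ∧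
      (BQF.act g p).A + (BQF.act g p).B + (BQF.act g p).C < 0 ∧
      0 < (BQF.act g q).A + (BQF.act g q).B + (BQF.act g q).C ∧ (BQF.act g q).C < 0 := by
  simp only [LeavesToRight, river, Set.mem_ofPred_eq, topograph_leftTurn, topograph_rightTurn]
  constructor
  · rintro ⟨d, h1, h2, h3⟩
    exact ⟨d.mat, h1, h2.2, h3⟩
  · rintro ⟨g, h1, h2, h3⟩
    obtain ⟨d, hd⟩ := exists_topograph_eq g
    refine ⟨d, ?_⟩
    rw [hd, hd]
    exact ⟨h1, ⟨h1.1, h2⟩, h3⟩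

theorem leavesToLeft_iff (p q : BQF) : LeavesToLeft (river p) (river q) ↔
    ∃ g : SL(2, ℤ), (BQF.act g p).IsRiverForm ∧
      0 < (BQF.act g p).A + (BQF.act g p).B + (BQF.act g p).C ∧
      0 < (BQF.act g q).A ∧ (BQF.act g q).A + (BQF.act g q).B + (BQF.act g q).C < 0 := by
  simp only [LeavesToLeft, river, Set.mem_ofPred_eq, topograph_leftTurn, topograph_rightTurn]
  constructor
  · rintro ⟨d, h1, h2, h3⟩
    exact ⟨d.mat, h1, h2.1, h3⟩
  · rintro ⟨g, h1, h2, h3⟩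
    obtain ⟨d, hd⟩ := exists_topograph_eq g
    refine ⟨d, ?_⟩
    rw [hd, hd]
    exact ⟨h1, ⟨h2, h1.2⟩, h3⟩

namespace BQF

theorem IsAnisotropic.secondRoot_mem_Ioo {q : BQF} (h : q.IsAnisotropic) (hC : 0 < q.C)
    (hs : q.A + q.B + q.C < 0) : 0 < q.secondRoot ∧ q.secondRoot < 1 := by
  have h1 := h.A_mul_roots_sub
  have h2 := h.sqrt_disc_pos
  have e0 := h.eval_eq 0
  have e1 := h.eval_eq 1
  have hC' : (0 : ℝ) < q.C := by exact_mod_cast hC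
  have hs' : (q.A : ℝ) + q.B + q.C < 0 := by exact_mod_cast hs
  simp only [eval] at e0 e1
  rw [← h1] at h2
  set x := q.firstRoot
  set y := q.secondRoot
  have f0 : 0 < (q.A : ℝ) * (x * y) := by linarith
  have f1 : (q.A : ℝ) * ((1 - x) * (1 - y)) < 0 := by linarith
  rcases lt_or_gt_of_ne h.A_cast_ne_zero with hA | hA
  · have hxy : x < y := by
      by_contra hc
      push Not at hc
      nlinarith
    have g0 : x * y < 0 := by
      by_contra hc
      push Not at hc
      nlinarith
    have g1 : 0 < (1 - x) * (1 - y) := by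
      by_contra hc
      push Not at hc
      nlinarith
    rcases mul_neg_iff.1 g0 with g | g
    · linarith
    · exact ⟨g.2, by linarith [pos_of_mul_pos_right g1 (by linarith)]⟩
  · have hxy : y < x := by
      by_contra hc
      push Not at hc
      nlinarith
    have g0 : 0 < x * y := pos_of_mul_pos_right f0 hA.le
    have g1 : (1 - x) * (1 - y) < 0 := by
      by_contra hc
      push Not at hc
      nlinarith
    rcases mul_neg_iff.1 g1 with g | g
    · linarith
    · exact ⟨pos_of_mul_pos_right g0 (by linarith), by linarith⟩

theorem IsAnisotropic.one_lt_firstRoot {q : BQF} (h : q.IsAnisotropic) (hA : 0 < q.A)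
    (hs : q.A + q.B + q.C < 0) : 1 < q.firstRoot := by
  have h1 := h.A_mul_roots_sub
  have h2 := h.sqrt_disc_pos
  have e1 := h.eval_eq 1
  have hA' : (0 : ℝ) < q.A := by exact_mod_cast hA
  have hs' : (q.A : ℝ) + q.B + q.C < 0 := by exact_mod_cast hs
  simp only [eval] at e1
  rw [← h1] at h2
  have hxy := pos_of_mul_pos_right h2 hA'.le
  by_contra hc
  push Not at hc
  have := mul_nonneg hA'.le (mul_nonneg (sub_nonneg.2 hc)
    (by linarith : 0 ≤ 1 - q.secondRoot))
  linarith

theorem IsAnisotropic.firstRoot_mem_Ioo {q : BQF} (h : q.IsAnisotropic) (hC : q.C < 0)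
    (hs : 0 < q.A + q.B + q.C) : 0 < q.firstRoot ∧ q.firstRoot < 1 := by
  rw [← h.secondRoot_neg]
  refine h.neg.secondRoot_mem_Ioo ?_ ?_ <;> simp only [neg_A, neg_B, neg_C] <;> omega

theorem IsAnisotropic.one_lt_secondRoot {q : BQF} (h : q.IsAnisotropic) (hA : q.A < 0)
    (hs : 0 < q.A + q.B + q.C) : 1 < q.secondRoot := by
  rw [← h.firstRoot_neg]
  refine h.neg.one_lt_firstRoot ?_ ?_ <;> simp only [neg_A, neg_B, neg_C] <;> omega

theorem IsRiverForm.eval_neg {p : BQF} (hp : p.IsRiverForm) (hs : p.A + p.B + p.C < 0) {x : ℝ}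
    (h0 : 0 < x) (h1 : x < 1) : p.eval x < 0 := by
  have hA : (0 : ℝ) < p.A := by exact_mod_cast hp.1
  have hC : (p.C : ℝ) < 0 := by exact_mod_cast hp.2
  have hs' : (p.A : ℝ) + p.B + p.C < 0 := by exact_mod_cast hs
  have e : p.eval x = x * (p.A + p.B + p.C) + (1 - x) * p.C - p.A * (x * (1 - x)) := by
    simp only [eval]; ring
  have a1 := mul_neg_of_pos_of_neg h0 hs'
  have a2 := mul_neg_of_pos_of_neg (sub_pos.2 h1) hC
  have a3 := mul_pos hA (mul_pos h0 (sub_pos.2 h1))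
  linarith

theorem IsRiverForm.eval_pos {p : BQF} (hp : p.IsRiverForm) (hs : 0 < p.A + p.B + p.C) {x : ℝ}
    (h1 : 1 < x) : 0 < p.eval x := by
  have hA : (0 : ℝ) < p.A := by exact_mod_cast hp.1
  have hC : (p.C : ℝ) < 0 := by exact_mod_cast hp.2
  have hs' : (0 : ℝ) < (p.A : ℝ) + p.B + p.C := by exact_mod_cast hs
  have h0 : 0 < x := one_pos.trans h1
  have e : p.eval x = x * (p.A + p.B + p.C) - (x - 1) * p.C + p.A * (x * (x - 1)) := by
    simp only [eval]; ring
  have a1 := mul_pos h0 hs'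
  have a2 := mul_neg_of_pos_of_neg (sub_pos.2 h1) hC
  have a3 := mul_pos hA (mul_pos h0 (sub_pos.2 h1))
  linarith

end BQF

theorem eval_secondRoot_neg_of_joinsFromRight {p q : BQF} (hq : q.IsAnisotropic)
    (h : JoinsFromRight (river p) (river q)) : p.eval q.secondRoot < 0 := by
  obtain ⟨g, h1, h2, h3, h4⟩ := (joinsFromRight_iff p q).1 h
  obtain ⟨c, hc, e⟩ := eval_act_secondRoot g p hq
  obtain ⟨r0, r1⟩ := (hq.act g).secondRoot_mem_Ioo h3 h4
  have := h1.eval_neg h2 r0 r1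
  rw [e] at this
  exact (pos_iff_neg_of_mul_neg this).1 hc

theorem eval_secondRoot_pos_of_joinsFromLeft {p q : BQF} (hq : q.IsAnisotropic)
    (h : JoinsFromLeft (river p) (river q)) : 0 < p.eval q.secondRoot := by
  obtain ⟨g, h1, h2, h3, h4⟩ := (joinsFromLeft_iff p q).1 h
  obtain ⟨c, hc, e⟩ := eval_act_secondRoot g p hq
  have := h1.eval_pos h2 ((hq.act g).one_lt_secondRoot h4 h3)
  rw [e] at this
  exact pos_of_mul_pos_right this hc.le

theorem eval_firstRoot_neg_of_leavesToRight {p q : BQF} (hq : q.IsAnisotropic)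
    (h : LeavesToRight (river p) (river q)) : p.eval q.firstRoot < 0 := by
  obtain ⟨g, h1, h2, h3, h4⟩ := (leavesToRight_iff p q).1 h
  obtain ⟨c, hc, e⟩ := eval_act_firstRoot g p hq
  obtain ⟨r0, r1⟩ := (hq.act g).firstRoot_mem_Ioo h4 h3
  have := h1.eval_neg h2 r0 r1
  rw [e] at this
  exact (pos_iff_neg_of_mul_neg this).1 hc

theorem eval_firstRoot_pos_of_leavesToLeft {p q : BQF} (hq : q.IsAnisotropic)
    (h : LeavesToLeft (river p) (river q)) : 0 < p.eval q.firstRoot := by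
  obtain ⟨g, h1, h2, h3, h4⟩ := (leavesToLeft_iff p q).1 h
  obtain ⟨c, hc, e⟩ := eval_act_firstRoot g p hq
  have := h1.eval_pos h2 ((hq.act g).one_lt_firstRoot h3 h4)
  rw [e] at this
  exact pos_of_mul_pos_right this hc.le

/-- At an edge where the river of `q` runs into the river of `p` with positive region ahead, the
latter arrives from the left and departs to the right. -/
theorem joinsFromRight_of_eval {p q : BQF} (hp : p.IsAnisotropic) (hq : q.IsAnisotropic)
    (h2 : p.eval q.secondRoot < 0) (h1 : 0 < p.eval q.firstRoot) :
    JoinsFromRight (river p) (river q) := by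
  obtain ⟨g, ⟨hA, hC⟩, hpA, hpC, hs⟩ := hp.exists_joining_edge hq h2 h1
  refine (joinsFromRight_iff p q).2 ⟨g * Turn.L.mat * matS, ?_⟩
  simp only [BQF.act_mul _ matS, BQF.act_mul g, act_S, act_L, BQF.IsRiverForm]
  refine ⟨⟨?_, ?_⟩, ?_, ?_, ?_⟩ <;> linarith

theorem leavesToLeft_of_eval {p q : BQF} (hp : p.IsAnisotropic) (hq : q.IsAnisotropic)
    (h2 : p.eval q.secondRoot < 0) (h1 : 0 < p.eval q.firstRoot) :
    LeavesToLeft (river p) (river q) := by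
  obtain ⟨g, ⟨hA, hC⟩, hpA, hpC, hs⟩ := hp.neg.exists_joining_edge hq.neg
    (by rw [hq.secondRoot_neg, BQF.eval_neg]; linarith)
    (by rw [hq.firstRoot_neg, BQF.eval_neg]; linarith)
  simp only [BQF.act_neg_form, BQF.neg_A, BQF.neg_B, BQF.neg_C] at hA hC hpA hpC hs
  refine (leavesToLeft_iff p q).2 ⟨g * Turn.R.mat * matS, ?_⟩
  simp only [BQF.act_mul _ matS, BQF.act_mul g, act_S, act_R, BQF.IsRiverForm]
  refine ⟨⟨?_, ?_⟩, ?_, ?_, ?_⟩ <;> linarith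

theorem joinsFromLeft_of_eval {p q : BQF} (hp : p.IsAnisotropic) (hq : q.IsAnisotropic)
    (h2 : 0 < p.eval q.secondRoot) (h1 : p.eval q.firstRoot < 0) :
    JoinsFromLeft (river p) (river q) := by
  obtain ⟨g, ⟨hA, hC⟩, hpA, hpC, hs⟩ := hp.neg.exists_joining_edge hq
    (by rw [BQF.eval_neg]; linarith) (by rw [BQF.eval_neg]; linarith)
  simp only [BQF.act_neg_form, BQF.neg_A, BQF.neg_B, BQF.neg_C] at hA hC hpA hpC hs
  refine (joinsFromLeft_iff p q).2 ⟨g * Turn.R.mat * matS, ?_⟩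
  simp only [BQF.act_mul _ matS, BQF.act_mul g, act_S, act_R, BQF.IsRiverForm]
  refine ⟨⟨?_, ?_⟩, ?_, ?_, ?_⟩ <;> linarith

theorem leavesToRight_of_eval {p q : BQF} (hp : p.IsAnisotropic) (hq : q.IsAnisotropic)
    (h2 : 0 < p.eval q.secondRoot) (h1 : p.eval q.firstRoot < 0) :
    LeavesToRight (river p) (river q) := by
  obtain ⟨g, ⟨hA, hC⟩, hpA, hpC, hs⟩ := hp.exists_joining_edge hq.neg
    (by rw [hq.secondRoot_neg]; exact h1) (by rw [hq.firstRoot_neg]; exact h2)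
  simp only [BQF.act_neg_form, BQF.neg_A, BQF.neg_C] at hA hC
  refine (leavesToRight_iff p q).2 ⟨g * Turn.L.mat * matS, ?_⟩
  simp only [BQF.act_mul _ matS, BQF.act_mul g, act_S, act_L, BQF.IsRiverForm]
  refine ⟨⟨?_, ?_⟩, ?_, ?_, ?_⟩ <;> linarith

theorem meetAndCross_iff {p q : BQF} (hp : p.IsAnisotropic) (hq : q.IsAnisotropic) :
    MeetAndCross (river p) (river q) ↔ p.eval q.firstRoot * p.eval q.secondRoot < 0 := by
  constructor
  · rintro (⟨h1, h2⟩ | ⟨h1, h2⟩)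
    · exact mul_neg_of_pos_of_neg (eval_firstRoot_pos_of_leavesToLeft hq h2)
        (eval_secondRoot_neg_of_joinsFromRight hq h1)
    · exact mul_neg_of_neg_of_pos (eval_firstRoot_neg_of_leavesToRight hq h2)
        (eval_secondRoot_pos_of_joinsFromLeft hq h1)
  · intro h
    rcases mul_neg_iff.1 h with ⟨h1, h2⟩ | ⟨h1, h2⟩
    · exact Or.inl ⟨joinsFromRight_of_eval hp hq h2 h1, leavesToLeft_of_eval hp hq h2 h1⟩
    · exact Or.inr ⟨joinsFromLeft_of_eval hp hq h2 h1, leavesToRight_of_eval hp hq h2 h1⟩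

theorem joinsFromRight_iff_of_cross {p q : BQF} (hp : p.IsAnisotropic) (hq : q.IsAnisotropic)
    (h : p.eval q.firstRoot * p.eval q.secondRoot < 0) :
    JoinsFromRight (river p) (river q) ↔ p.eval q.secondRoot < 0 :=
  ⟨eval_secondRoot_neg_of_joinsFromRight hq, fun h2 =>
    joinsFromRight_of_eval hp hq h2 ((pos_iff_neg_of_mul_neg h).2 h2)⟩

theorem joinsFromLeft_iff_of_cross {p q : BQF} (hp : p.IsAnisotropic) (hq : q.IsAnisotropic)
    (h : p.eval q.firstRoot * p.eval q.secondRoot < 0) :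
    JoinsFromLeft (river p) (river q) ↔ 0 ≤ p.eval q.secondRoot :=
  ⟨fun h2 => (eval_secondRoot_pos_of_joinsFromLeft hq h2).le, fun h2 => by
    have h3 : p.eval q.secondRoot ≠ 0 := fun h0 => by simp [h0] at h
    have h4 := lt_of_le_of_ne h2 h3.symm
    exact joinsFromLeft_of_eval hp hq h4 ((neg_iff_pos_of_mul_neg h).2 h4)⟩

/-! ### Overlapping rivers and periods -/

theorem mem_or_rev_mem_river_iff {q : BQF} (d : Dart) :
    (d ∈ river q ∨ d.rev ∈ river q) ↔ (topograph q d).A * (topograph q d).C < 0 := by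
  simp only [river, Set.mem_ofPred_eq, topograph_rev]
  rw [mul_neg_iff, and_comm (a := 0 < (topograph q d).C)]

theorem BQF.Proportional.act {p q : BQF} (h : p.Proportional q) (g : SL(2, ℤ)) :
    q.A * (BQF.act g p).A = p.A * (BQF.act g q).A ∧
      q.A * (BQF.act g p).C = p.A * (BQF.act g q).C := by
  obtain ⟨h1, h2⟩ := h
  simp only [BQF.act]
  constructor
  · linear_combination (g 0 0 * g 1 0) * h1 + (g 1 0) ^ 2 * h2
  · linear_combination (g 0 1 * g 1 1) * h1 + (g 1 1) ^ 2 * h2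

theorem completelyOverlap_iff {p q : BQF} (hp : p.IsAnisotropic) (hq : q.IsAnisotropic) :
    CompletelyOverlap (river p) (river q) ↔ p.Proportional q := by
  simp only [CompletelyOverlap, mem_or_rev_mem_river_iff]
  constructor
  · intro h
    refine hq.proportional_of_eval_firstRoot (hq.eval_firstRoot_eq_zero fun g hg => ?_)
    obtain ⟨d, hd⟩ := exists_topograph_eq g
    have h1 := h d
    rw [hd, hd] at h1
    exact h1.2 (mul_neg_of_pos_of_neg hg.1 hg.2)
  · intro h d
    obtain ⟨h1, h2⟩ := h.act d.mat
    have a1 : 0 < p.A ^ 2 := by have := hp.A_ne_zero; positivity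
    have a2 : 0 < q.A ^ 2 := by have := hq.A_ne_zero; positivity
    have e : q.A ^ 2 * ((topograph p d).A * (topograph p d).C)
        = p.A ^ 2 * ((topograph q d).A * (topograph q d).C) := by
      simp only [topograph]
      linear_combination (q.A * (BQF.act d.mat p).C) * h1 + (p.A * (BQF.act d.mat q).A) * h2
    constructor
    · intro h3
      have := mul_neg_of_pos_of_neg a2 h3
      rw [e] at this
      exact (pos_iff_neg_of_mul_neg this).1 a1
    · intro h3
      have := mul_neg_of_pos_of_neg a1 h3
      rw [← e] at this
      exact (pos_iff_neg_of_mul_neg this).1 a2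

theorem BQF.Proportional.eq_or_eq_neg {p q : BQF} (hq : q.IsAnisotropic)
    (h : p.Proportional q) (hd : p.disc = q.disc) : p = q ∨ p = q.neg := by
  obtain ⟨h1, h2⟩ := h
  have hA := hq.A_ne_zero
  have e : q.disc * (q.A ^ 2 - p.A ^ 2) = 0 := by
    have e1 : q.A ^ 2 * p.disc = p.A ^ 2 * q.disc := by
      simp only [BQF.disc]
      linear_combination (q.A * p.B + p.A * q.B) * h1 - 4 * q.A * p.A * h2
    rw [hd] at e1
    linear_combination e1
  have e2 := (mul_eq_zero.1 e).resolve_left hq.disc_pos.ne'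
  have e3 : (p.A - q.A) * (p.A + q.A) = 0 := by linear_combination -e2
  rcases mul_eq_zero.1 e3 with e4 | e4
  · left
    have e5 : p.A = q.A := by omega
    rw [e5] at h1 h2
    exact BQF.ext e5 (mul_left_cancel₀ hA h1) (mul_left_cancel₀ hA h2)
  · right
    have e5 : p.A = -q.A := by omega
    rw [e5] at h1 h2
    exact BQF.ext e5 (mul_left_cancel₀ hA (by rw [h1]; simp))
      (mul_left_cancel₀ hA (by rw [h2]; simp))

/-- The periods of the river of `q` are the automorphs of `q`. -/
theorem mem_riverPeriods_iff {q : BQF} (hq : q.IsAnisotropic) {τ : planeAut} {σ : SL(2, ℤ)}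
    (h : InducedBy τ σ) : τ ∈ riverPeriods q ↔ σ ∈ q.automorphs := by
  have hact : ∀ d, topograph q (τ.1 d) = topograph (BQF.act σ q) d := fun d => by
    rw [topograph, (h d).act_eq, BQF.act_mul]; rfl
  constructor
  · intro hτ
    have h1 : ∀ g : SL(2, ℤ), (BQF.act g (BQF.act σ q)).IsRiverForm ↔
        (BQF.act g q).IsRiverForm := by
      intro g
      obtain ⟨d, hd⟩ := exists_topograph_eq g
      have h2 := hτ d
      simp only [river, Set.mem_ofPred_eq, hact, hd] at h2
      exact h2
    have h2 : (BQF.act σ q).Proportional q :=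
      hq.proportional_of_eval_firstRoot (hq.eval_firstRoot_eq_zero fun g hg =>
        mul_neg_of_pos_of_neg ((h1 g).2 hg).1 ((h1 g).2 hg).2)
    rcases h2.eq_or_eq_neg hq (BQF.disc_act σ q) with h3 | h3
    · exact h3
    · exfalso
      obtain ⟨g, hg⟩ := hq.exists_isRiverForm
      have h4 := (h1 g).2 hg
      rw [h3, BQF.act_neg_form] at h4
      have h5 := h4.1
      have h6 := hg.1
      simp only [BQF.neg_A] at h5
      omega
  · intro hσ d
    have e : BQF.act σ q = q := hσ
    simp only [river, Set.mem_ofPred_eq, hact, e]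

/-! ### The sign of a crossing -/

theorem sg_eq_ite {p : BQF} (hp : p.IsAnisotropic) (q : BQF) [Decidable (p.eval q.secondRoot < 0)] :
    BQF.sg p q = if p.eval q.secondRoot < 0 then 1 else -1 := by
  split_ifs with h
  · exact (sg_eq_one_iff hp q).2 h
  · exact (sg_eq_neg_one_iff hp q).2 (not_lt.1 h)

theorem sg_act {p q : BQF} (hp : p.IsAnisotropic) (hq : q.IsAnisotropic) (g : SL(2, ℤ)) :
    BQF.sg (BQF.act g p) (BQF.act g q) = BQF.sg p q := by
  classical
  obtain ⟨c, hc, e⟩ := eval_act_secondRoot g p hq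
  rw [sg_eq_ite (hp.act g), sg_eq_ite hp, e]
  simp only [mul_neg_iff, hc, hc.not_gt, true_and, false_and, or_false]

theorem existsUnique_act_iff {p q : BQF} (hp : p.IsAnisotropic) (hq : q.IsAnisotropic)
    (g : SL(2, ℤ)) :
    (∃! z : ℍ, z ∈ (BQF.act g p).rootGeodesic ∧ z ∈ (BQF.act g q).rootGeodesic) ↔
      MeetAndCross (river p) (river q) := by
  obtain ⟨c, hc, e⟩ := eval_act_secondRoot g p hq
  obtain ⟨c', hc', e'⟩ := eval_act_firstRoot g p hq
  rw [existsUnique_common_point_iff (hp.act g) (hq.act g), meetAndCross_iff hp hq, e, e',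
    mul_mul_mul_comm]
  have h := mul_pos hc' hc
  exact ⟨fun hn => (pos_iff_neg_of_mul_neg hn).1 h, mul_neg_of_pos_of_neg h⟩

theorem existsUnique_iff {p q : BQF} (hp : p.IsAnisotropic) (hq : q.IsAnisotropic) :
    (∃! z : ℍ, z ∈ p.rootGeodesic ∧ z ∈ q.rootGeodesic) ↔ MeetAndCross (river p) (river q) := by
  rw [existsUnique_common_point_iff hp hq, meetAndCross_iff hp hq]

theorem rootGeodesic_act_eq_iff {p q : BQF} (hp : p.IsAnisotropic) (hq : q.IsAnisotropic)
    (g : SL(2, ℤ)) : (BQF.act g p).rootGeodesic = (BQF.act g q).rootGeodesic ↔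
      CompletelyOverlap (river p) (river q) := by
  rw [completelyOverlap_iff hp hq, ← rootGeodesic_eq_iff hp hq]
  simp only [Set.ext_iff, hp.mem_rootGeodesic_act, hq.mem_rootGeodesic_act]
  exact (MulAction.surjective g).forall (p := fun z : ℍ => z ∈ p.rootGeodesic ↔ z ∈ q.rootGeodesic)
    |>.symm

theorem sign_eq_sg {q₁ q₂ : BQF} (h₁ : q₁.IsAnisotropic) (h₂ : q₂.IsAnisotropic)
    (φ : CrossingSuperposition q₁ q₂) {σ : SL(2, ℤ)} (h : InducedBy φ.1 σ) :
    φ.sign = BQF.sg (BQF.act σ⁻¹ q₁) q₂ := by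
  classical
  have hc := φ.2
  rw [h.superimposedRiver_eq, meetAndCross_iff (h₁.act _) h₂] at hc
  rw [CrossingSuperposition.sign, sg_eq_ite (h₁.act _), h.superimposedRiver_eq]
  simp only [joinsFromRight_iff_of_cross (h₁.act σ⁻¹) h₂ hc]

theorem LiftedIntersection.sign_eq_sg {q₁ q₂ : BQF} (h₁ : q₁.IsAnisotropic)
    (x : LiftedIntersection q₁ q₂) : x.sign = BQF.sg (BQF.act x.σ⁻¹ q₁) q₂ := by
  rw [BQF.sg, h₁.firstRoot_act, h₁.secondRoot_act, inv_inv]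
  rfl

theorem sign_eq_of_equiv {q₁ q₂ : BQF} (h₁ : q₁.IsAnisotropic) (h₂ : q₂.IsAnisotropic)
    {φ ψ : CrossingSuperposition q₁ q₂} (h : periodSetoid q₁ q₂ φ ψ) : φ.sign = ψ.sign := by
  obtain ⟨τ₁, ht₁, τ₂, ht₂, e⟩ := h
  obtain ⟨σ, hσ⟩ := exists_inducedBy φ.1
  obtain ⟨σ₁, hσ₁⟩ := exists_inducedBy τ₁
  obtain ⟨σ₂, hσ₂⟩ := exists_inducedBy τ₂
  have hψ : InducedBy ψ.1 (σ₂ * σ * σ₁) := by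
    rw [e]; exact (hσ₂.mul hσ).mul hσ₁
  have e₁ : BQF.act σ₁⁻¹ q₁ = q₁ := inv_mem ((mem_riverPeriods_iff h₁ hσ₁).1 ht₁)
  have e₂ : BQF.act σ₂⁻¹ q₂ = q₂ := inv_mem ((mem_riverPeriods_iff h₂ hσ₂).1 ht₂)
  rw [sign_eq_sg h₁ h₂ φ hσ, sign_eq_sg h₁ h₂ ψ hψ, mul_inv_rev, mul_inv_rev, BQF.act_mul,
    BQF.act_mul, e₁]
  conv_rhs => rw [← e₂]
  rw [sg_act (h₁.act _) h₂]

/-! ### Intersections and river crossings -/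

/-- The automorphism of the plane tree that belongs to an element of the modular group. -/
noncomputable def planeAutOf (σ : SL(2, ℤ)) : planeAut := (exists_planeAut σ).choose

theorem inducedBy_planeAutOf (σ : SL(2, ℤ)) : InducedBy (planeAutOf σ) σ :=
  (exists_planeAut σ).choose_spec

theorem LiftedIntersection.existsUnique {q₁ q₂ : BQF} (h₁ : q₁.IsAnisotropic)
    (h₂ : q₂.IsAnisotropic) (x : LiftedIntersection q₁ q₂) :
    ∃! z : ℍ, z ∈ (BQF.act x.σ⁻¹ q₁).rootGeodesic ∧ z ∈ q₂.rootGeodesic := by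
  have h3 := x.transverse
  rw [h₁.image_rootGeodesic] at h3
  refine existsUnique_of_common_point (h₁.act _) h₂ (z := x.z₂) ?_ x.mem₂ h3
  rw [h₁.mem_rootGeodesic_act, ← x.smul_eq, inv_smul_smul]
  exact x.mem₁

/-- The superposition that belongs to a transverse intersection: the first topograph is placed on
the second one by means of the matrix that carries the one branch to the other. -/
noncomputable def LiftedIntersection.toCrossing {q₁ q₂ : BQF} (h₁ : q₁.IsAnisotropic)
    (h₂ : q₂.IsAnisotropic) (x : LiftedIntersection q₁ q₂) : CrossingSuperposition q₁ q₂ :=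
  ⟨planeAutOf x.σ, by
    rw [(inducedBy_planeAutOf x.σ).superimposedRiver_eq, ← existsUnique_iff (h₁.act _) h₂]
    exact x.existsUnique h₁ h₂⟩

theorem LiftedIntersection.inducedBy_toCrossing {q₁ q₂ : BQF} (h₁ : q₁.IsAnisotropic)
    (h₂ : q₂.IsAnisotropic) (x : LiftedIntersection q₁ q₂) :
    InducedBy (x.toCrossing h₁ h₂).1 x.σ := inducedBy_planeAutOf x.σ

theorem toCrossing_equiv {q₁ q₂ : BQF} (h₁ : q₁.IsAnisotropic) (h₂ : q₂.IsAnisotropic)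
    {x y : LiftedIntersection q₁ q₂} (h : liftSetoid q₁ q₂ x y) :
    periodSetoid q₁ q₂ (x.toCrossing h₁ h₂) (y.toCrossing h₁ h₂) := by
  obtain ⟨g₁, hg₁, g₂, hg₂, -, -, e⟩ := h
  have i₁ := inducedBy_planeAutOf g₁⁻¹
  have i₂ := inducedBy_planeAutOf g₂
  refine ⟨_, (mem_riverPeriods_iff h₁ i₁).2 (inv_mem hg₁), _, (mem_riverPeriods_iff h₂ i₂).2 hg₂,
    InducedBy.eq (y.inducedBy_toCrossing h₁ h₂) ?_⟩
  rw [e]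
  exact (i₂.mul (x.inducedBy_toCrossing h₁ h₂)).mul i₁

theorem equiv_of_toCrossing_equiv {q₁ q₂ : BQF} (h₁ : q₁.IsAnisotropic) (h₂ : q₂.IsAnisotropic)
    {x y : LiftedIntersection q₁ q₂}
    (h : periodSetoid q₁ q₂ (x.toCrossing h₁ h₂) (y.toCrossing h₁ h₂)) :
    liftSetoid q₁ q₂ x y := by
  obtain ⟨τ₁, ht₁, τ₂, ht₂, e⟩ := h
  obtain ⟨σ₁, hσ₁⟩ := exists_inducedBy τ₁
  obtain ⟨σ₂, hσ₂⟩ := exists_inducedBy τ₂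
  have m₁ := (mem_riverPeriods_iff h₁ hσ₁).1 ht₁
  have m₂ := (mem_riverPeriods_iff h₂ hσ₂).1 ht₂
  have hy := (hσ₂.mul (x.inducedBy_toCrossing h₁ h₂)).mul hσ₁
  rw [← e] at hy
  -- The sign ambiguity is absorbed by the automorph of `q₂`.
  obtain ⟨g₂, hg₂, eσ⟩ : ∃ g₂ ∈ q₂.automorphs, y.σ = g₂ * x.σ * (σ₁⁻¹)⁻¹ := by
    rw [inv_inv]
    rcases (y.inducedBy_toCrossing h₁ h₂).signEq hy with h3 | h3
    · exact ⟨σ₂, m₂, h3⟩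
    · exact ⟨-σ₂, (BQF.act_neg_mat σ₂ q₂).trans m₂, by rw [h3]; simp⟩
  have k₁ : σ₁⁻¹ ∈ q₁.automorphs := inv_mem m₁
  have mem₁ : σ₁⁻¹ • x.z₁ ∈ q₁.rootGeodesic := by
    rw [← h₁.mem_rootGeodesic_act, show BQF.act σ₁⁻¹ q₁ = q₁ from k₁]; exact x.mem₁
  have mem₂ : g₂ • x.z₂ ∈ q₂.rootGeodesic := by
    rw [← h₂.mem_rootGeodesic_act, show BQF.act g₂ q₂ = q₂ from hg₂]; exact x.mem₂
  have hw : y.σ • σ₁⁻¹ • x.z₁ = g₂ • x.z₂ := by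
    rw [eσ, ← mul_smul, inv_mul_cancel_right, mul_smul, x.smul_eq]
  have hz₂ : y.z₂ = g₂ • x.z₂ := by
    refine (y.existsUnique h₁ h₂).unique ⟨?_, y.mem₂⟩ ⟨?_, mem₂⟩
    · rw [h₁.mem_rootGeodesic_act, ← y.smul_eq, inv_smul_smul]; exact y.mem₁
    · rw [h₁.mem_rootGeodesic_act, ← hw, inv_smul_smul]; exact mem₁
  refine ⟨σ₁⁻¹, k₁, g₂, hg₂, ?_, hz₂, eσ⟩
  rw [← y.smul_eq, ← hw] at hz₂
  exact (MulAction.injective y.σ) hz₂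

theorem exists_toCrossing_eq {q₁ q₂ : BQF} (h₁ : q₁.IsAnisotropic) (h₂ : q₂.IsAnisotropic)
    (φ : CrossingSuperposition q₁ q₂) :
    ∃ x : LiftedIntersection q₁ q₂, x.toCrossing h₁ h₂ = φ := by
  obtain ⟨σ, hσ⟩ := exists_inducedBy φ.1
  have hc := φ.2
  rw [hσ.superimposedRiver_eq, ← existsUnique_iff (h₁.act _) h₂] at hc
  obtain ⟨z, hz₁, hz₂⟩ := hc.exists
  rw [h₁.mem_rootGeodesic_act] at hz₁
  refine ⟨⟨σ⁻¹ • z, z, σ, hz₁, hz₂, smul_inv_smul σ z, ?_⟩, ?_⟩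
  · rw [h₁.image_rootGeodesic]
    exact rootGeodesic_ne_of_existsUnique h₂ hc
  · exact Subtype.ext (InducedBy.eq (LiftedIntersection.inducedBy_toCrossing h₁ h₂ _) hσ)

/-- Transverse intersections correspond to river crossings modulo periods. -/
noncomputable def intersectionsEquiv {q₁ q₂ : BQF} (h₁ : q₁.IsAnisotropic)
    (h₂ : q₂.IsAnisotropic) : Intersections q₁ q₂ ≃ RiverCrossings q₁ q₂ :=
  Equiv.ofBijective
    (Quotient.map (sa := liftSetoid q₁ q₂) (sb := periodSetoid q₁ q₂)
      (fun x => x.toCrossing h₁ h₂) fun _ _ h => toCrossing_equiv h₁ h₂ h) <| by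
    constructor
    · intro a b
      refine Quotient.inductionOn₂ (s₁ := liftSetoid q₁ q₂) (s₂ := liftSetoid q₁ q₂) a b ?_
      intro x y e
      exact Quotient.sound (s := liftSetoid q₁ q₂)
        (equiv_of_toCrossing_equiv h₁ h₂ (Quotient.exact (s := periodSetoid q₁ q₂) e))
    · intro c
      refine Quotient.inductionOn (s := periodSetoid q₁ q₂) c ?_
      intro φ
      obtain ⟨x, rfl⟩ := exists_toCrossing_eq h₁ h₂ φ
      exact ⟨Quotient.mk (liftSetoid q₁ q₂) x, rfl⟩

theorem signedIntNumber_eq {q₁ q₂ : BQF} (h₁ : q₁.IsAnisotropic) (h₂ : q₂.IsAnisotropic) :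
    signedIntNumber q₁ q₂ = signedRiverCrossings q₁ q₂ := by
  rw [signedIntNumber, signedRiverCrossings, ← finsum_comp_equiv (intersectionsEquiv h₁ h₂)]
  refine finsum_congr fun c => ?_
  have e : intersectionsEquiv h₁ h₂ c = Quotient.mk (periodSetoid q₁ q₂)
      ((Quotient.out c : LiftedIntersection q₁ q₂).toCrossing h₁ h₂) := by
    conv_lhs => rw [← Quotient.out_eq c]
    rfl
  rw [e, sign_eq_of_equiv h₁ h₂ (Quotient.mk_out (s := periodSetoid q₁ q₂) _),
    sign_eq_sg h₁ h₂ _ (LiftedIntersection.inducedBy_toCrossing h₁ h₂ _),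
    LiftedIntersection.sign_eq_sg h₁]

/-! ### Finiteness -/

/-- The river of `q` and that of `p` have a common edge if they meet and cross. -/
theorem exists_common_edge {p q : BQF} (hq : q.IsAnisotropic)
    (h : MeetAndCross (river p) (river q)) : ∃ g : SL(2, ℤ), (BQF.act g p).IsRiverForm ∧
      ((BQF.act g q).IsRiverForm ∨ (BQF.act g q).neg.IsRiverForm) := by
  rcases h with ⟨h, -⟩ | ⟨h, -⟩
  · obtain ⟨g, h1, h2, h3, h4⟩ := (joinsFromRight_iff p q).1 h
    rcases lt_or_gt_of_ne (hq.act g).A_ne_zero with hA | hA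
    · exact ⟨g, h1, Or.inr ⟨neg_pos.2 hA, neg_neg_of_pos h3⟩⟩
    · refine ⟨g * Turn.L.mat, ?_, Or.inl ?_⟩ <;> rw [BQF.act_mul, act_L]
      · exact ⟨h1.1, h2⟩
      · exact ⟨hA, h4⟩
  · obtain ⟨g, h1, h2, h3, h4⟩ := (joinsFromLeft_iff p q).1 h
    rcases lt_or_gt_of_ne (hq.act g).C_ne_zero with hC | hC
    · refine ⟨g * Turn.R.mat, ?_, Or.inl ?_⟩ <;> rw [BQF.act_mul, act_R]
      · exact ⟨h2, h1.2⟩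
      · exact ⟨h3, hC⟩
    · exact ⟨g, h1, Or.inr ⟨neg_pos.2 h4, neg_neg_of_pos hC⟩⟩

/-- Forms with coefficients bounded by `D`. -/
def boundedForms (D : ℤ) : Set BQF := {q | |q.A| ≤ D ∧ |q.B| ≤ D ∧ |q.C| ≤ D}

theorem finite_boundedForms (D : ℤ) : (boundedForms D).Finite := by
  have hf : Function.Injective fun q : BQF => (q.A, q.B, q.C) := fun p q e => by
    simp only [Prod.mk.injEq] at e
    exact BQF.ext e.1 e.2.1 e.2.2
  refine (Set.Finite.preimage hf.injOn (((Set.finite_Icc (-D) D).prod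
    ((Set.finite_Icc (-D) D).prod (Set.finite_Icc (-D) D))))).subset ?_
  rintro q ⟨h1, h2, h3⟩
  exact ⟨abs_le.1 h1, abs_le.1 h2, abs_le.1 h3⟩

theorem BQF.IsRiverForm.mem_boundedForms {q : BQF} (h : q.IsRiverForm) :
    q ∈ boundedForms q.disc := by
  obtain ⟨h1, h2, h3⟩ := h.bounds
  refine ⟨?_, h2, ?_⟩
  · rwa [abs_of_pos h.1]
  · rwa [abs_of_neg h.2]

theorem neg_mem_boundedForms {q : BQF} {D : ℤ} (h : q.neg ∈ boundedForms D) :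
    q ∈ boundedForms D := by
  simpa [boundedForms] using h

theorem CrossingSuperposition.exists_dart {q₁ q₂ : BQF} (h₂ : q₂.IsAnisotropic)
    (φ : CrossingSuperposition q₁ q₂) : ∃ d : Dart,
      topograph q₁ d ∈ boundedForms q₁.disc ∧ topograph q₂ (φ.1.1 d) ∈ boundedForms q₂.disc := by
  obtain ⟨σ, hσ⟩ := exists_inducedBy φ.1
  have hc := φ.2
  rw [hσ.superimposedRiver_eq] at hc
  obtain ⟨g, hg1, hg2⟩ := exists_common_edge h₂ hc
  obtain ⟨d', hd'⟩ := exists_topograph_eq g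
  obtain ⟨d, rfl⟩ := φ.1.1.surjective d'
  refine ⟨d, ?_, ?_⟩
  · rw [← hσ.topograph_eq, hd']
    have := hg1.mem_boundedForms
    rwa [BQF.disc_act, BQF.disc_act] at this
  · rw [hd']
    rcases hg2 with h | h
    · have := h.mem_boundedForms
      rwa [BQF.disc_act] at this
    · have := h.mem_boundedForms
      rw [BQF.disc_neg, BQF.disc_act] at this
      exact neg_mem_boundedForms this

/-- Two oriented edges with the same form differ by a period. -/
theorem exists_period {q : BQF} (hq : q.IsAnisotropic) {d d' : Dart}
    (h : topograph q d = topograph q d') : ∃ τ ∈ riverPeriods q, τ.1 d = d' := by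
  have i := inducedBy_planeAutOf (d'.mat * d.mat⁻¹)
  refine ⟨_, (mem_riverPeriods_iff hq i).2 ?_, Dart.mat_injective ((i d).trans (Or.inl ?_))⟩
  · change BQF.act _ q = q
    have h' : BQF.act d.mat q = BQF.act d'.mat q := h
    rw [BQF.act_mul, ← h', ← BQF.act_mul, mul_inv_cancel, BQF.act_one]
  · rw [inv_mul_cancel_right]

/-- There are finitely many crossings, because a crossing is determined modulo periods by the pair
of forms at a common edge of the two rivers, and these forms are bounded. -/
theorem finite_riverCrossings {q₁ q₂ : BQF} (h₁ : q₁.IsAnisotropic) (h₂ : q₂.IsAnisotropic) :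
    Finite (RiverCrossings q₁ q₂) := by
  choose D hD₁ hD₂ using fun φ : CrossingSuperposition q₁ q₂ => φ.exists_dart h₂
  have : Finite (boundedForms q₁.disc) := finite_boundedForms _
  have : Finite (boundedForms q₂.disc) := finite_boundedForms _
  let out : RiverCrossings q₁ q₂ → CrossingSuperposition q₁ q₂ :=
    fun c => Quotient.out (s := periodSetoid q₁ q₂) c
  let f : RiverCrossings q₁ q₂ → boundedForms q₁.disc × boundedForms q₂.disc :=
    fun c => (⟨_, hD₁ (out c)⟩, ⟨_, hD₂ (out c)⟩)
  refine Finite.of_injective f fun c c' e => ?_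
  simp only [f, Prod.mk.injEq, Subtype.mk.injEq] at e
  obtain ⟨τ₁, ht₁, e₁⟩ := exists_period h₁ e.1.symm
  obtain ⟨τ₂, ht₂, e₂⟩ := exists_period h₂ e.2
  refine Quotient.out_equiv_out.1 ⟨τ₁, ht₁, τ₂, ht₂, ?_⟩
  refine InducedBy.eq_of_apply_eq (d := D (out c')) ?_
  have e₃ : (τ₂ * (out c).1 * τ₁).1 (D (out c')) = τ₂.1 ((out c).1.1 (τ₁.1 (D (out c')))) := rfl
  exact (e₃.trans (by rw [e₁, e₂])).symm

end ModularTopograph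

theorem mainTheorem4 (q₁ q₂ : BQF) (h₁ : q₁.IsPIBQF) (h₂ : q₂.IsPIBQF) :
    -- superimposing at forms `f₁`, `f₂` of the two topographs: crossing, overlap and sign
    (∀ (φ : planeAut) (d : Dart) (f₁ f₂ : BQF),
      topograph q₁ d = f₁ → topograph q₂ (φ.1 d) = f₂ →
        ((∃! z : ℍ, z ∈ f₁.rootGeodesic ∧ z ∈ f₂.rootGeodesic) ↔
          MeetAndCross (superimposedRiver q₁ φ) (river q₂)) ∧
        (f₁.rootGeodesic = f₂.rootGeodesic ↔
          CompletelyOverlap (superimposedRiver q₁ φ) (river q₂)) ∧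
        ((∃! z : ℍ, z ∈ f₁.rootGeodesic ∧ z ∈ f₂.rootGeodesic) →
          (BQF.sg f₁ f₂ = 1 ↔ JoinsFromRight (superimposedRiver q₁ φ) (river q₂)) ∧
          (BQF.sg f₁ f₂ = -1 ↔ JoinsFromLeft (superimposedRiver q₁ φ) (river q₂)))) ∧
    -- the unweighted and the signed intersection number
    Finite (Intersections q₁ q₂) ∧
    Finite (RiverCrossings q₁ q₂) ∧
    intNumber q₁ q₂ = Nat.card (RiverCrossings q₁ q₂) ∧
    signedIntNumber q₁ q₂ = signedRiverCrossings q₁ q₂ := by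
  have a₁ := h₁.isAnisotropic
  have a₂ := h₂.isAnisotropic
  have hfin := finite_riverCrossings a₁ a₂
  refine ⟨?_, Finite.of_equiv _ (intersectionsEquiv a₁ a₂).symm, hfin,
    Nat.card_congr (intersectionsEquiv a₁ a₂), signedIntNumber_eq a₁ a₂⟩
  rintro φ d _ _ rfl rfl
  obtain ⟨σ, hσ⟩ := exists_inducedBy φ
  rw [hσ.superimposedRiver_eq, ← hσ.topograph_eq q₁ d]
  have ap := a₁.act σ⁻¹
  refine ⟨existsUnique_act_iff ap a₂ _, rootGeodesic_act_eq_iff ap a₂ _, fun hu => ?_⟩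
  have hc := (meetAndCross_iff ap a₂).1 ((existsUnique_act_iff ap a₂ _).1 hu)
  rw [joinsFromRight_iff_of_cross ap a₂ hc, joinsFromLeft_iff_of_cross ap a₂ hc, topograph,
    topograph, sg_act ap a₂]
  exact ⟨sg_eq_one_iff ap q₂, sg_eq_neg_one_iff ap q₂⟩
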